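/- Setting. Let $X\in\mathbb R^{n\times p}$ be a random matrix with i.i.d. centered rows whose covariance matrix is $\Sigma=\operatorname{diag}(\lambda_1,\dots,\lambda_p)$ with $\lambda_1\ge\dots\ge\lambda_p>0$, and suppose that the rows of $X\Sigma^{-1/2}$ have sub-gaussian norm at most $\sigma_x$. Here $\|Z\|_{\psi_2}=\inf\{t>0:\mathbb E\exp(Z^2/t^2)\le 2\}$ for a random variable and $\|Z\|_{\psi_2}=\sup_{s\ne0}\|\langle s,Z\rangle/\|s\|\|_{\psi_2}$ for a random vector. Let $\varepsilon\in\mathbb R^n$ be noise that is independent of $X$ and has independent centered components with sub-gaussian norms at most $\sigma_\varepsilon>0$, and let $\theta^*\in\mathbb R^p$. For $\lambda\in\mathbb R$ put $$B=\|(I_p-X^\top(\lambda I_n+XX^\top)^{-1}X)\theta^*\|_\Sigma^2,\qquad V=\|X^\top(\lambda I_n+XX^\top)^{-1}\varepsilon\|_\Sigma^2,$$ where $\|x\|_M=\sqrt{x^\top Mx}$. For $0\le k<p$ let $\theta^*_{0:k}$ and $\theta^*_{k:\infty}$ be the vectors of the first $k$ and of the remaining coordinates of $\theta^*$, and $\Sigma_{0:k}=\operatorname{diag}(\lambda_1,\dots,\lambda_k)$,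 $\Sigma_{k:\infty}=\operatorname{diag}(\lambda_{k+1},\dots,\lambda_p)$. Theorem. For every $\sigma_x$ and every $a>0$ there are constants $c_x,C_x>0$ that depend only on $\sigma_x$ and $a$ ($a$ enters only part 1) such that for all $n$, $p$, $\sigma_\varepsilon$, $\theta^*$ and all $X$, $\varepsilon$ as above, every integer $0\le k<p$ with $k<n/c_x$ and every $t\in(c_x,n/c_x)$ the following holds. 1. If $\sum_{i>k}\lambda_i\le a\,n\lambda_{k+1}$ and $\lambda=n\lambda_{k+1}$, then with probability at least $1-26e^{-t/c_x}$ the matrix $\lambda I_n+XX^\top$ is non-degenerate and $$B\le C_x\Big(\|\theta^*_{k:\infty}\|^2_{\Sigma_{k:\infty}}+\lambda_{k+1}^2\|\theta^*_{0:k}\|^2_{\Sigma_{0:k}^{-1}}\Big),\qquad \frac{V}{\sigma_\varepsilon^2t}\le C_x\Big(\frac kn+\frac{\sum_{i>k}\lambda_i^2}{n\lambda_{k+1}^2}\Big).$$ 2. Suppose that the components of each row of $X$ are independent and that $\sum_{i>k}\lambda_i\ge c_xn\lambda_{k+1}$. (a) For every $0\le\lambda<\sum_{i>k}\lambda_i$,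 with probability at least $1-22e^{-t/c_x}$ the matrix $\lambda I_n+XX^\top$ is non-degenerate and $$B\le C_x\Big(\|\theta^*_{k:\infty}\|^2_{\Sigma_{k:\infty}}+\|\theta^*_{0:k}\|^2_{\Sigma_{0:k}^{-1}}\Big(\frac{\sum_{i>k}\lambda_i}{n}\Big)^2\Big),\qquad \frac{V}{\sigma_\varepsilon^2t}\le C_x\Big(\frac kn+\frac{n\sum_{i>k}\lambda_i^2}{(\sum_{i>k}\lambda_i)^2}\Big).$$ (b) For every $\xi>c_x$ and $\lambda=-\sum_{i>k}\lambda_i+\xi\big(n\lambda_{k+1}+\sqrt{n\sum_{i>k}\lambda_i^2}\big)$, with probability at least $1-20e^{-t/c_x}$ the matrix $\lambda I_n+XX^\top$ is non-degenerate and $$B\le C_x\Big(\|\theta^*_{k:\infty}\|^2_{\Sigma_{k:\infty}}+\|\theta^*_{0:k}\|^2_{\Sigma_{0:k}^{-1}}\frac{\xi^2}{n}\Big(n\lambda_{k+1}^2+\sum_{i>k}\lambda_i^2\Big)\Big),\qquad \frac{V}{\sigma_\varepsilon^2t}\le C_x\Big(\frac kn+\frac{\sum_{i>k}\lambda_i^2}{\xi^2\big(n\lambda_{k+1}^2+\sum_{i>k}\lambda_i^2\big)}\Big).$$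 -/

import Mathlib

open MeasureTheory ProbabilityTheory Matrix
open scoped ENNReal NNReal

noncomputable section

namespace RidgeRegression

/-- The sub-gaussian norm `inf {t > 0 : E exp (Z² / t²) ≤ 2}` of a real random variable,
with value `∞` when no such `t` exists. -/
def psi2Norm {Ω : Type*} [MeasurableSpace Ω] (μ : Measure Ω) (Z : Ω → ℝ) : ℝ≥0∞ :=
  ⨅ (t : ℝ≥0) (_ : 0 < t)
    (_ : ∫⁻ ω, ENNReal.ofReal (Real.exp (Z ω ^ 2 / (t : ℝ) ^ 2)) ∂μ ≤ 2), (t : ℝ≥0∞)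

/-- The sub-gaussian norm of a random vector: the supremum over `s ≠ 0` of the sub-gaussian norm
of `⟨s, Z⟩ / ‖s‖` (Euclidean norm). -/
def psi2NormVec {Ω : Type*} [MeasurableSpace Ω] {p : ℕ} (μ : Measure Ω)
    (Z : Ω → EuclideanSpace ℝ (Fin p)) : ℝ≥0∞ :=
  ⨆ (s : EuclideanSpace ℝ (Fin p)) (_ : s ≠ 0), psi2Norm μ (fun ω => inner ℝ s (Z ω) / ‖s‖)

/-- `‖x‖_M = √(xᵀ M x)`. -/
def matNorm {ι : Type*} [Fintype ι] (M : Matrix ι ι ℝ) (x : ι → ℝ) : ℝ :=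
  √(x ⬝ᵥ (M *ᵥ x))

/-- The first `k` coordinates of a vector. -/
def head {p : ℕ} (k : ℕ) (η : Fin p → ℝ) : {j : Fin p // (j : ℕ) < k} → ℝ := fun j => η j

/-- All coordinates of a vector but the first `k`. -/
def tail {p : ℕ} (k : ℕ) (η : Fin p → ℝ) : {j : Fin p // k ≤ (j : ℕ)} → ℝ := fun j => η j

/-- `∑_{i > k} λ_i`. -/
def tailSum {p : ℕ} (k : ℕ) (lam : Fin p → ℝ) : ℝ := ∑ j, tail k lam j

/-- `∑_{i > k} λ_i²`. -/
def tailSqSum {p : ℕ} (k : ℕ) (lam : Fin p → ℝ) : ℝ := ∑ j, tail k lam j ^ 2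

/-- `‖θ_{0:k}‖²` in the norm given by the inverse of `Σ_{0:k} = diag(λ_1, …, λ_k)`. -/
def headTerm {p : ℕ} (k : ℕ) (lam θ : Fin p → ℝ) : ℝ :=
  matNorm (diagonal (head k lam))⁻¹ (head k θ) ^ 2

/-- `‖θ_{k:∞}‖²` in the norm given by `Σ_{k:∞} = diag(λ_{k+1}, …, λ_p)`. -/
def tailTerm {p : ℕ} (k : ℕ) (lam θ : Fin p → ℝ) : ℝ :=
  matNorm (diagonal (tail k lam)) (tail k θ) ^ 2

/-- The matrix `l I_n + X Xᵀ`. -/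
def gram {n p : ℕ} (l : ℝ) (X : Matrix (Fin n) (Fin p) ℝ) : Matrix (Fin n) (Fin n) ℝ :=
  l • (1 : Matrix (Fin n) (Fin n) ℝ) + X * Xᵀ

/-- The bias term `‖(I_p - Xᵀ (l I_n + X Xᵀ)⁻¹ X) θ‖²_Σ`, where `Σ = diag lam`. -/
def biasTerm {n p : ℕ} (lam : Fin p → ℝ) (l : ℝ) (X : Matrix (Fin n) (Fin p) ℝ)
    (θ : Fin p → ℝ) : ℝ :=
  matNorm (diagonal lam)
    (((1 : Matrix (Fin p) (Fin p) ℝ) - Xᵀ * (gram l X)⁻¹ * X) *ᵥ θ) ^ 2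

/-- The variance term `‖Xᵀ (l I_n + X Xᵀ)⁻¹ ε‖²_Σ`, where `Σ = diag lam`. -/
def varTerm {n p : ℕ} (lam : Fin p → ℝ) (l : ℝ) (X : Matrix (Fin n) (Fin p) ℝ)
    (ε : Fin n → ℝ) : ℝ :=
  matNorm (diagonal lam) ((Xᵀ * (gram l X)⁻¹) *ᵥ ε) ^ 2

/-- The assumptions on the design and the noise. `X ω i` is the `i`-th row of the design matrix
and `lam` lists the eigenvalues of the (invertible, diagonal) covariance of a row. -/
structure Model {Ω : Type*} [MeasurableSpace Ω] (μ : Measure Ω) {n p : ℕ} (σx σε : ℝ)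
    (lam : Fin p → ℝ) (X : Ω → Fin n → Fin p → ℝ) (ε : Ω → Fin n → ℝ) : Prop where
  measurable_design : Measurable X
  measurable_noise : Measurable ε
  eig_pos : ∀ j, 0 < lam j
  eig_antitone : Antitone lam
  rows_indep : iIndepFun (fun i ω => X ω i) μ
  rows_identDistrib : ∀ i i', IdentDistrib (fun ω => X ω i) (fun ω => X ω i') μ μ
  rows_centered : ∀ i j, ∫ ω, X ω i j ∂μ = 0
  rows_cov : ∀ i j j', covariance (fun ω => X ω i j) (fun ω => X ω i j') μ = diagonal lam j j'
  /-- the rows of `X Σ^{-1/2}` have sub-gaussian norm at most `σx` -/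
  rows_subgaussian : ∀ i,
    psi2NormVec μ (fun ω => WithLp.toLp 2 (fun j => X ω i j / √(lam j))) ≤ ENNReal.ofReal σx
  noise_indep_design : IndepFun X ε μ
  noise_indep : iIndepFun (fun i ω => ε ω i) μ
  noise_centered : ∀ i, ∫ ω, ε ω i ∂μ = 0
  noise_subgaussian : ∀ i, psi2Norm μ (fun ω => ε ω i) ≤ ENNReal.ofReal σε

/-- The event that `l I_n + X Xᵀ` is non-degenerate, the bias term is at most `bB`, and
`V / (σε² t)` is at most `bV`. -/
def goodEvent {Ω : Type*} {n p : ℕ} (σε t : ℝ) (lam : Fin p → ℝ) (l : ℝ)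
    (X : Ω → Fin n → Fin p → ℝ) (ε : Ω → Fin n → ℝ) (θ : Fin p → ℝ) (bB bV : ℝ) : Set Ω :=
  {ω | IsUnit (gram l (Matrix.of (X ω))) ∧
    biasTerm lam l (Matrix.of (X ω)) θ ≤ bB ∧
    varTerm lam l (Matrix.of (X ω)) (ε ω) / (σε ^ 2 * t) ≤ bV}

end RidgeRegression

end

open RidgeRegression

/-! Write X = Z Σ^{1/2} with isotropic rows and split the columns at k, so that λI + XXᵀ = A +
Z₁Σ₁Z₁ᵀ, where A is the ridge plus the Gram matrix of the tail columns and Z₁, Σ₁ belong to the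
head. The theorem holds because A behaves like a multiple of the identity: m ≤ A ≤ M with M/m
bounded.

Granted this, and n/2 ≤ Z₁ᵀZ₁ ≤ 3n/2, which holds because k is small compared with n, the rest is
deterministic. Let v = (λI + XXᵀ)⁻¹Xθ, let r be the head of θ - Xᵀv and w = Σ₁^{1/2} r, so that |w|²
is the head part of B. Then Av = Z₁w + z, where z is the tail part of the signal Xθ, and ⟨Z₁w, v⟩ ≤
⟨w, Σ₁^{-1/2}θ₁⟩ since the difference is |r|². As ⟨Z₁w, A⁻¹Z₁w⟩ ≥ |Z₁w|²/M ≥ n|w|²/(2M), this bounds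
w; that is `head_bound`, in which the head eigenvalues do not appear. The tail part of B follows
from m|v| ≤ |Z₁w + z| (`bias_bound`). The head part of V comes from the same lemma with z = 0
(`variance_head_bound`). What remains of V are quadratic forms of the noise whose coefficients
depend on X only; conditionally on X they are at most of order σ_ε² t times a squared Frobenius
norm, with probability at least 1 - 2exp(-t) (`measureReal_noise_random_le`).

The regimes differ in how A is controlled. For λ = nλ_{k+1} the ridge alone gives the lower bound,
and an upper bound for the tail Gram matrix suffices. `measureReal_colGram_le` proves it without
independence inside a row: Gaussian linearization of the squares, then a net. If the entries of a
row are independent, Bernstein's inequality on a net shows in `measureReal_colGram_sub_le` that the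
tail Gram matrix is (∑_{i>k} λ_i) I up to an error of order D = nλ_{k+1} + √(n∑_{i>k} λ_i²). Under
the effective rank assumption D is small against the sum, so every λ ≥ 0 below the sum is allowed;
with λ + ∑_{i>k} λ_i = ξD and ξ large the error is absorbed even when λ is negative. -/

noncomputable section

namespace RidgeRegression

/-! ### Sub-Gaussian variables through exponential moments of their squares -/

section

/-- The linear term has mean zero for a centered variable, so the moment generating function is
controlled by an exponential moment of the square. -/
lemma exp_le_add_exp_sq (x : ℝ) : Real.exp x ≤ x + Real.exp (x ^ 2) := by
  have h1 : 1 + x ^ 2 ≤ Real.exp (x ^ 2) := by linarith [Real.add_one_le_exp (x ^ 2)]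
  rcases le_total |x| 1 with h | h
  · have := (abs_le.1 (Real.abs_exp_sub_one_sub_id_le h)).2
    linarith
  · rcases le_abs'.1 h with h | h
    · have : Real.exp x ≤ 1 := Real.exp_le_one_iff.2 (by linarith)
      nlinarith
    · have : Real.exp x ≤ Real.exp (x ^ 2) := Real.exp_le_exp.2 (by nlinarith)
      linarith

/-- Convexity on the segment from 0 to y. After integration it turns a moment bound 2 into 1 + r,
which tends to 1 with r. -/
lemma exp_mul_le_of_mem_unit {r : ℝ} (h0 : 0 ≤ r) (h1 : r ≤ 1) (y : ℝ) :
    Real.exp (r * y) ≤ 1 - r + r * Real.exp y := by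
  have := convexOn_exp.2 (Set.mem_univ 0) (Set.mem_univ y) (sub_nonneg.2 h1) h0 (by ring)
  simpa using this

/-- Second-order Taylor bound for Bernstein's inequality: centering removes the linear term, and the
remainder is quadratic in the parameter. -/
lemma exp_le_one_add_add_sq_mul_exp (x : ℝ) :
    Real.exp x ≤ 1 + x + x ^ 2 * Real.exp |x| := by
  have h1 : 1 ≤ Real.exp |x| := Real.one_le_exp (abs_nonneg x)
  rcases le_total |x| 1 with h | h
  · have := (abs_le.1 (Real.abs_exp_sub_one_sub_id_le h)).2
    nlinarith [sq_nonneg x]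
  · rcases le_abs'.1 h with h | h
    · have : Real.exp x ≤ 1 := Real.exp_le_one_iff.2 (by linarith)
      nlinarith
    · rw [abs_of_nonneg (by linarith)]
      nlinarith [mul_nonneg (show 0 ≤ x ^ 2 - 1 by nlinarith) (Real.exp_pos x).le]

lemma exp_half_le_two : Real.exp (1 / 2) ≤ 2 := by
  have := Real.exp_one_lt_d9
  have e : Real.exp (1 / 2) ^ 2 = Real.exp 1 := by rw [← Real.exp_nat_mul]; norm_num
  nlinarith [Real.exp_pos (1 / 2)]

variable {Ω : Type*} [MeasurableSpace Ω] {μ : Measure Ω}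

/-- The square of `Y` has exponential moment of order `b` at most `2`. -/
def SqExpLE (μ : Measure Ω) (b : ℝ) (Y : Ω → ℝ) : Prop :=
  Integrable (fun ω => Real.exp (b * Y ω ^ 2)) μ ∧ ∫ ω, Real.exp (b * Y ω ^ 2) ∂μ ≤ 2

lemma sqExpLE_iff {b : ℝ} {Y : Ω → ℝ} (hY : Measurable Y) :
    SqExpLE μ b Y ↔ ∫⁻ ω, ENNReal.ofReal (Real.exp (b * Y ω ^ 2)) ∂μ ≤ 2 := by
  have hm : AEStronglyMeasurable (fun ω => Real.exp (b * Y ω ^ 2)) μ :=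
    Measurable.aestronglyMeasurable (by fun_prop)
  have h0 : 0 ≤ᵐ[μ] fun ω => Real.exp (b * Y ω ^ 2) := ae_of_all _ fun ω => (Real.exp_pos _).le
  constructor
  · rintro ⟨hi, h⟩
    rw [← ofReal_integral_eq_lintegral_ofReal hi h0]
    exact ENNReal.ofReal_le_of_le_toReal (by simpa using h)
  · intro h
    have hi : Integrable (fun ω => Real.exp (b * Y ω ^ 2)) μ :=
      (lintegral_ofReal_ne_top_iff_integrable hm h0).1 (ne_top_of_le_ne_top (by simp) h)
    refine ⟨hi, ?_⟩
    rw [integral_eq_lintegral_of_nonneg_ae h0 hm]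
    exact ENNReal.toReal_le_of_le_ofReal (by norm_num) (by simpa using h)

lemma sqExpLE_of_psi2Norm_lt {Y : Ω → ℝ} (hY : Measurable Y) {K : ℝ} (hK : 0 < K)
    (h : psi2Norm μ Y < ENNReal.ofReal K) : SqExpLE μ (1 / K ^ 2) Y := by
  rw [sqExpLE_iff hY]
  -- The strict inequality yields an admissible t below K, so attainment of the infimum need not be
  -- discussed.
  simp only [psi2Norm, iInf_lt_iff] at h
  obtain ⟨t, ht0, ht, htK⟩ := h
  refine le_trans (lintegral_mono fun ω => ENNReal.ofReal_le_ofReal (Real.exp_le_exp.2 ?_)) ht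
  have htK' : (t : ℝ) < K := by
    rw [← ENNReal.ofReal_coe_nnreal] at htK
    exact (ENNReal.ofReal_lt_ofReal_iff hK).1 htK
  have : (0 : ℝ) < t := ht0
  rw [one_div, inv_mul_eq_div]
  gcongr

section

variable {b : ℝ} {Y : Ω → ℝ}

lemma SqExpLE.integrable_sq (hb : 0 < b) (hY : Measurable Y) (h : SqExpLE μ b Y) :
    Integrable (fun ω => Y ω ^ 2) μ := by
  refine (h.1.const_mul (1 / b)).mono' (by fun_prop) (ae_of_all _ fun ω => ?_)
  rw [Real.norm_of_nonneg (sq_nonneg _), one_div, inv_mul_eq_div, le_div_iff₀ hb]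
  linarith [Real.add_one_le_exp (b * Y ω ^ 2)]

lemma SqExpLE.memLp_two (hb : 0 < b) (hY : Measurable Y) (h : SqExpLE μ b Y) :
    MemLp Y 2 μ :=
  (memLp_two_iff_integrable_sq hY.aestronglyMeasurable).2 (h.integrable_sq hb hY)

variable [IsProbabilityMeasure μ]

lemma SqExpLE.integral_sq_le (hb : 0 < b) (hY : Measurable Y) (h : SqExpLE μ b Y) :
    ∫ ω, Y ω ^ 2 ∂μ ≤ 1 / b := by
  have h1 : ∫ ω, b * Y ω ^ 2 ∂μ ≤ ∫ ω, (Real.exp (b * Y ω ^ 2) - 1) ∂μ :=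
    integral_mono ((h.integrable_sq hb hY).const_mul b) (h.1.sub (integrable_const 1))
      fun ω => by simp only; linarith [Real.add_one_le_exp (b * Y ω ^ 2)]
  rw [integral_const_mul, integral_sub h.1 (integrable_const 1)] at h1
  simp only [integral_const, probReal_univ, one_smul] at h1
  rw [le_div_iff₀ hb]
  linarith [h.2]

lemma SqExpLE.integrable_exp_mul_sq (hY : Measurable Y) (h : SqExpLE μ b Y)
    {r : ℝ} (h0 : 0 ≤ r) (h1 : r ≤ 1) :
    Integrable (fun ω => Real.exp (r * (b * Y ω ^ 2))) μ ∧
      ∫ ω, Real.exp (r * (b * Y ω ^ 2)) ∂μ ≤ 1 + r := by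
  have hi : Integrable (fun ω => 1 - r + r * Real.exp (b * Y ω ^ 2)) μ :=
    (integrable_const _).add (h.1.const_mul r)
  have hle := fun ω => exp_mul_le_of_mem_unit h0 h1 (b * Y ω ^ 2)
  have hi' : Integrable (fun ω => Real.exp (r * (b * Y ω ^ 2))) μ :=
    hi.mono' (by fun_prop) (ae_of_all _ fun ω => by
      rw [Real.norm_of_nonneg (Real.exp_pos _).le]; exact hle ω)
  refine ⟨hi', (integral_mono hi' hi hle).trans ?_⟩
  rw [integral_add (integrable_const _) (h.1.const_mul r), integral_const_mul]
  simp only [integral_const, probReal_univ, one_smul]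
  nlinarith [h.2]

/-- A centered variable whose square has a bounded exponential moment has a sub-Gaussian moment
generating function. -/
lemma SqExpLE.hasSubgaussianMGF (hb : 0 < b) (hY : Measurable Y) (h0 : ∫ ω, Y ω ∂μ = 0)
    (h : SqExpLE μ b Y) : HasSubgaussianMGF Y (2 / b).toNNReal μ := by
  have hYi : Integrable Y μ := (h.memLp_two hb hY).integrable (by norm_num)
  have key : ∀ t : ℝ, Integrable (fun ω => Real.exp (t * Y ω)) μ ∧
      ∫ ω, Real.exp (t * Y ω) ∂μ ≤ Real.exp (t ^ 2 / b) := by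
    intro t
    have hr0 : 0 ≤ t ^ 2 / b := by positivity
    rcases le_total (t ^ 2 / b) 1 with hr | hr
    -- For small t the vanishing mean gives the bound 1 + t²/b. For large t the mean is irrelevant,
    -- and tY ≤ t²/(2b) + bY²/2 suffices.
    · obtain ⟨hi, hle⟩ := h.integrable_exp_mul_sq hY hr0 hr
      have he : ∀ ω, t ^ 2 / b * (b * Y ω ^ 2) = (t * Y ω) ^ 2 := fun ω => by field_simp
      simp only [he] at hi hle
      have hI : Integrable (fun ω => t * Y ω + Real.exp ((t * Y ω) ^ 2)) μ :=
        (hYi.const_mul t).add hi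
      have hp := fun ω => exp_le_add_exp_sq (t * Y ω)
      have hi' : Integrable (fun ω => Real.exp (t * Y ω)) μ :=
        hI.mono' (by fun_prop) (ae_of_all _ fun ω => by
          rw [Real.norm_of_nonneg (Real.exp_pos _).le]; exact hp ω)
      refine ⟨hi', (integral_mono hi' hI hp).trans ?_⟩
      rw [integral_add (hYi.const_mul t) hi, integral_const_mul, h0]
      linarith [Real.add_one_le_exp (t ^ 2 / b)]
    · obtain ⟨hi, hle⟩ := h.integrable_exp_mul_sq hY (r := 1 / 2) (by norm_num) (by norm_num)
      have hI := hi.const_mul (Real.exp (t ^ 2 / b / 2))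
      have hp : ∀ ω, Real.exp (t * Y ω) ≤
          Real.exp (t ^ 2 / b / 2) * Real.exp (1 / 2 * (b * Y ω ^ 2)) := fun ω => by
        rw [← Real.exp_add]
        refine Real.exp_le_exp.2 ?_
        have : 0 ≤ (t - b * Y ω) ^ 2 / b := by positivity
        have e : (t - b * Y ω) ^ 2 / b = t ^ 2 / b - 2 * (t * Y ω) + b * Y ω ^ 2 := by
          field_simp; ring
        linarith
      have hi' : Integrable (fun ω => Real.exp (t * Y ω)) μ :=
        hI.mono' (by fun_prop) (ae_of_all _ fun ω => by
          rw [Real.norm_of_nonneg (Real.exp_pos _).le]; exact hp ω)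
      refine ⟨hi', (integral_mono hi' hI hp).trans ?_⟩
      rw [integral_const_mul]
      have h3 : (1 + 1 / 2 : ℝ) ≤ Real.exp (t ^ 2 / b / 2) := by
        linarith [Real.add_one_le_exp (t ^ 2 / b / 2)]
      calc _ ≤ Real.exp (t ^ 2 / b / 2) * Real.exp (t ^ 2 / b / 2) := by
            gcongr; exact hle.trans h3
        _ = _ := by rw [← Real.exp_add]; congr 1; ring
  refine ⟨fun t => (key t).1, fun t => (key t).2.trans_eq ?_⟩
  rw [Real.coe_toNNReal _ (by positivity)]
  congr 1
  field_simp

/-- Bernstein's bound for the moment generating function of a centered square. -/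
lemma SqExpLE.mgf_sq_sub_le (hb : 0 < b) (hY : Measurable Y) (h : SqExpLE μ b Y)
    {v : ℝ} (hv : ∫ ω, Y ω ^ 2 ∂μ = v) {s : ℝ} (hs : |s| ≤ b / 4) :
    Integrable (fun ω => Real.exp (s * (Y ω ^ 2 - v))) μ ∧
      mgf (fun ω => Y ω ^ 2 - v) μ s ≤ Real.exp (128 * s ^ 2 / b ^ 2) := by
  have hvb : v ≤ 1 / b := hv ▸ h.integral_sq_le hb hY
  have hv0 : 0 ≤ v := hv ▸ integral_nonneg fun ω => sq_nonneg _
  have hYi := h.integrable_sq hb hY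
  have hp : ∀ ω, Real.exp (s * (Y ω ^ 2 - v)) ≤
      1 + s * (Y ω ^ 2 - v) + 64 * s ^ 2 / b ^ 2 * Real.exp (b * Y ω ^ 2) := by
    intro ω
    refine (exp_le_one_add_add_sq_mul_exp _).trans ?_
    gcongr 1 + _ + ?_
    set U := Y ω ^ 2 - v
    -- In terms of q, the factor U² costs 2exp(q) and exp|sU| costs another exp(q); 2q stays below
    -- bY² + 1/2, so everything fits under exp(bY²).
    set q := b * |U| / 4 with hq
    have hq0 : 0 ≤ q := by positivity
    have hU : |U| = 4 * q / b := by rw [hq]; field_simp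
    have hsq : q ^ 2 ≤ 2 * Real.exp q := by
      have := Real.quadratic_le_exp_of_nonneg hq0
      nlinarith
    have h1 : |s * U| ≤ q := by
      rw [abs_mul]
      calc |s| * |U| ≤ b / 4 * |U| := by gcongr
        _ = q := by rw [hq]; ring
    have hUle : |U| ≤ Y ω ^ 2 + 1 / b := by
      rw [abs_le]; constructor <;> simp only [U] <;> nlinarith [sq_nonneg (Y ω), one_div_pos.2 hb]
    have h2 : 2 * q ≤ 1 / 2 + b * Y ω ^ 2 := by
      have : b * |U| ≤ b * (Y ω ^ 2 + 1 / b) := by gcongr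
      have e : b * (1 / b) = 1 := by field_simp
      rw [hq]
      nlinarith [sq_nonneg (Y ω), mul_nonneg hb.le (sq_nonneg (Y ω))]
    have h3 := exp_half_le_two
    calc (s * U) ^ 2 * Real.exp |s * U| ≤ (s * U) ^ 2 * Real.exp q := by gcongr
      _ = s ^ 2 * (16 / b ^ 2) * (q ^ 2 * Real.exp q) := by
        rw [mul_pow, ← sq_abs U, hU]; field_simp; ring
      _ ≤ s ^ 2 * (16 / b ^ 2) * (2 * Real.exp q * Real.exp q) := by gcongr
      _ = s ^ 2 * (32 / b ^ 2) * Real.exp (2 * q) := by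
        rw [two_mul q, Real.exp_add]; ring
      _ ≤ s ^ 2 * (32 / b ^ 2) * Real.exp (1 / 2 + b * Y ω ^ 2) := by gcongr
      _ = s ^ 2 * (32 / b ^ 2) * (Real.exp (1 / 2) * Real.exp (b * Y ω ^ 2)) := by
        rw [Real.exp_add]
      _ ≤ s ^ 2 * (32 / b ^ 2) * (2 * Real.exp (b * Y ω ^ 2)) := by gcongr
      _ = _ := by ring
  have hI0 : Integrable (fun ω => s * (Y ω ^ 2 - v)) μ :=
    (hYi.sub (integrable_const v)).const_mul s
  have hI1 : Integrable (fun ω => 1 + s * (Y ω ^ 2 - v)) μ :=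
    (integrable_const _).add hI0
  have hI2 := h.1.const_mul (64 * s ^ 2 / b ^ 2)
  have hi' : Integrable (fun ω => Real.exp (s * (Y ω ^ 2 - v))) μ :=
    (hI1.add hI2).mono' (by fun_prop) (ae_of_all _ fun ω => by
      rw [Real.norm_of_nonneg (Real.exp_pos _).le]; exact hp ω)
  refine ⟨hi', (integral_mono hi' (hI1.add hI2) hp).trans ?_⟩
  simp only [Pi.add_apply]
  rw [integral_add hI1 hI2, integral_add (integrable_const _) hI0, integral_const_mul, integral_const_mul,
    integral_sub hYi (integrable_const v), hv]
  simp only [integral_const, probReal_univ, one_smul, sub_self, mul_zero, add_zero]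
  have : 64 * s ^ 2 / b ^ 2 * ∫ ω, Real.exp (b * Y ω ^ 2) ∂μ ≤ 64 * s ^ 2 / b ^ 2 * 2 := by
    gcongr; exact h.2
  have e : 64 * s ^ 2 / b ^ 2 * 2 = 128 * s ^ 2 / b ^ 2 := by ring
  linarith [Real.add_one_le_exp (128 * s ^ 2 / b ^ 2)]

end

end

/-! ### Linearizing squares with Gaussian variables -/

section

/-- The integral is (1 - 2b)^{-1/2}, and (1 + 4b)(1 - 2b) ≥ 1 exactly because b ≤ 1/4. -/
lemma lintegral_exp_sq_gaussianReal_le {b : ℝ} (h0 : 0 ≤ b) (hb : b ≤ 1 / 4) :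
    ∫⁻ x, ENNReal.ofReal (Real.exp (b * x ^ 2)) ∂(gaussianReal 0 1) ≤
      ENNReal.ofReal (Real.exp (2 * b)) := by
  rw [gaussianReal_of_var_ne_zero _ one_ne_zero,
    lintegral_withDensity_eq_lintegral_mul _ (measurable_gaussianPDF _ _) (by fun_prop)]
  have e : ∀ x : ℝ, (gaussianPDF 0 1 * fun x => ENNReal.ofReal (Real.exp (b * x ^ 2))) x =
      ENNReal.ofReal ((√(2 * Real.pi))⁻¹ * Real.exp (-(1 / 2 - b) * x ^ 2)) := by
    intro x
    simp only [Pi.mul_apply, gaussianPDF, gaussianPDFReal]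
    rw [← ENNReal.ofReal_mul (by positivity), mul_assoc, ← Real.exp_add]
    congr 2
    · simp
    · congr 1; simp; ring
  simp_rw [e]
  rw [← ofReal_integral_eq_lintegral_ofReal
    ((integrable_exp_neg_mul_sq (by linarith)).const_mul _)
    (ae_of_all _ fun x => by positivity), integral_const_mul, integral_gaussian]
  refine ENNReal.ofReal_le_ofReal ?_
  rw [← Real.sqrt_inv, ← Real.sqrt_mul (by positivity)]
  refine Real.sqrt_le_iff.2 ⟨(Real.exp_pos _).le, ?_⟩
  have hpi := Real.pi_pos
  have e1 : (2 * Real.pi)⁻¹ * (Real.pi / (1 / 2 - b)) = 1 / (1 - 2 * b) := by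
    have : (1 / 2 - b) ≠ 0 := by linarith
    have : (1 - 2 * b) ≠ 0 := by linarith
    field_simp
  have e2 : Real.exp (2 * b) ^ 2 = Real.exp (4 * b) := by
    rw [← Real.exp_nat_mul]; congr 1; push_cast; ring
  rw [e1, e2, div_le_iff₀ (by linarith)]
  have := Real.add_one_le_exp (4 * b)
  nlinarith

lemma lintegral_exp_mul_gaussianReal (t : ℝ) :
    ∫⁻ x, ENNReal.ofReal (Real.exp (t * x)) ∂(gaussianReal 0 1) =
      ENNReal.ofReal (Real.exp (t ^ 2 / 2)) := by
  have h := mgf_gaussianReal (p := gaussianReal 0 1) (X := id) (μ := 0) (v := 1) (by simp) t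
  rw [← ofReal_integral_eq_lintegral_ofReal (integrable_exp_mul_gaussianReal t)
    (ae_of_all _ fun x => (Real.exp_pos _).le)]
  simp only [mgf, id] at h
  rw [h]; simp

variable {Ω : Type*} [MeasurableSpace Ω] {μ : Measure Ω}

lemma lintegral_exp_mul_le_of_hasSubgaussianMGF {Y : Ω → ℝ} {c : ℝ≥0}
    (h : HasSubgaussianMGF Y c μ) (t : ℝ) :
    ∫⁻ ω, ENNReal.ofReal (Real.exp (t * Y ω)) ∂μ ≤ ENNReal.ofReal (Real.exp (c * t ^ 2 / 2)) := by
  rw [← ofReal_integral_eq_lintegral_ofReal (h.integrable_exp_mul t)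
    (ae_of_all _ fun x => (Real.exp_pos _).le)]
  exact ENNReal.ofReal_le_ofReal (h.mgf_le t)

/-- A linear combination of independent centered sub-Gaussian variables. -/
lemma hasSubgaussianMGF_sum_mul {ι : Type*} [Fintype ι] {Y : ι → Ω → ℝ}
    (hi : iIndepFun Y μ) {c : ℝ≥0} (h : ∀ i, HasSubgaussianMGF (Y i) c μ) (u : ι → ℝ)
    {s : ℝ≥0} (hu : ∑ i, u i ^ 2 = s) :
    HasSubgaussianMGF (fun ω => ∑ i, u i * Y i ω) (s * c) μ := by
  have := HasSubgaussianMGF.sum_of_iIndepFun (X := fun i ω => u i * Y i ω)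
    (hi.comp (fun i x => u i * x) fun i => by fun_prop)
    (s := Finset.univ) fun i _ => (h i).const_mul (u i)
  refine ⟨this.integrable_exp_mul, fun t => (this.mgf_le t).trans_eq ?_⟩
  rw [NNReal.coe_sum, NNReal.coe_mul, ← hu, Finset.sum_mul _ _ (c : ℝ)]
  rfl

variable [IsProbabilityMeasure μ]

/-- Exponential moments of a weighted sum of squares of the coordinates of a sub-Gaussian random
vector, by integrating its moment generating function against Gaussian coordinates. -/
lemma lintegral_exp_sum_sq_le {ι : Type*} [Fintype ι] {Y : ι → Ω → ℝ}
    (hY : ∀ j, Measurable (Y j)) {K : ℝ} (hK : 0 ≤ K)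
    (h : ∀ s : ι → ℝ, ∫⁻ ω, ENNReal.ofReal (Real.exp (∑ j, s j * Y j ω)) ∂μ ≤
      ENNReal.ofReal (Real.exp (K * ∑ j, s j ^ 2)))
    {a : ι → ℝ} (ha : ∀ j, 0 ≤ a j) (haK : ∀ j, 8 * (a j * K) ≤ 1) :
    ∫⁻ ω, ENNReal.ofReal (Real.exp (∑ j, a j * Y j ω ^ 2)) ∂μ ≤
      ENNReal.ofReal (Real.exp (4 * K * ∑ j, a j)) := by
  classical
  -- The squares are removed one at a time by exp(aY²) = E exp(√(2a) g Y) with g standard Gaussian.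
  -- The linear part s vanishes on J, so that √(2a) g can be inserted into the free coordinate i
  -- before the induction hypothesis is applied.
  suffices H : ∀ (J : Finset ι) (s : ι → ℝ), (∀ j ∈ J, s j = 0) →
      ∫⁻ ω, ENNReal.ofReal (Real.exp (∑ j, s j * Y j ω + ∑ j ∈ J, a j * Y j ω ^ 2)) ∂μ ≤
        ENNReal.ofReal (Real.exp (K * ∑ j, s j ^ 2 + 4 * K * ∑ j ∈ J, a j)) by
    simpa using H Finset.univ 0 (by simp)
  intro J
  induction J using Finset.induction_on with
  | empty => intro s _; simpa using h s
  | insert i J hi ih =>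
    intro s hs
    have hsi : s i = 0 := hs i (Finset.mem_insert_self i J)
    set r := √(2 * a i) with hr
    have hr2 : r ^ 2 = 2 * a i := Real.sq_sqrt (by linarith [ha i])
    have hlin : ∀ (g : ℝ) (ω : Ω), ∑ j, Function.update s i (r * g) j * Y j ω =
        ∑ j, s j * Y j ω + r * g * Y i ω := by
      intro g ω
      rw [← Finset.add_sum_erase _ _ (Finset.mem_univ i),
        ← Finset.add_sum_erase _ (fun j => s j * Y j ω) (Finset.mem_univ i), hsi]
      simp only [Function.update_self, zero_mul, zero_add]
      rw [add_comm]
      congr 1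
      refine Finset.sum_congr rfl fun j hj => ?_
      rw [Function.update_of_ne (Finset.ne_of_mem_erase hj)]
    have hsq : ∀ g : ℝ, ∑ j, Function.update s i (r * g) j ^ 2 =
        ∑ j, s j ^ 2 + 2 * a i * g ^ 2 := by
      intro g
      rw [← Finset.add_sum_erase _ _ (Finset.mem_univ i),
        ← Finset.add_sum_erase _ (fun j => s j ^ 2) (Finset.mem_univ i), hsi]
      simp only [Function.update_self, mul_pow, hr2]
      rw [add_comm]
      simp only [ne_eq, OfNat.ofNat_ne_zero, not_false_eq_true, zero_pow, zero_add]
      congr 1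
      refine Finset.sum_congr rfl fun j hj => ?_
      rw [Function.update_of_ne (Finset.ne_of_mem_erase hj)]
    have hpt : ∀ ω, ENNReal.ofReal
        (Real.exp (∑ j, s j * Y j ω + ∑ j ∈ insert i J, a j * Y j ω ^ 2)) =
        ∫⁻ g, ENNReal.ofReal (Real.exp (∑ j, s j * Y j ω + r * g * Y i ω +
          ∑ j ∈ J, a j * Y j ω ^ 2)) ∂(gaussianReal 0 1) := by
      intro ω
      have e : ∀ g : ℝ, ENNReal.ofReal (Real.exp (∑ j, s j * Y j ω + r * g * Y i ω +
          ∑ j ∈ J, a j * Y j ω ^ 2)) =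
          ENNReal.ofReal (Real.exp (∑ j, s j * Y j ω + ∑ j ∈ J, a j * Y j ω ^ 2)) *
            ENNReal.ofReal (Real.exp (r * Y i ω * g)) := by
        intro g
        rw [← ENNReal.ofReal_mul (Real.exp_pos _).le, ← Real.exp_add]
        congr 2; ring
      simp_rw [e]
      rw [lintegral_const_mul _ (by fun_prop), lintegral_exp_mul_gaussianReal,
        ← ENNReal.ofReal_mul (Real.exp_pos _).le, ← Real.exp_add, Finset.sum_insert hi,
        mul_pow, hr2]
      congr 2; ring
    simp_rw [hpt]
    rw [lintegral_lintegral_swap (by fun_prop)]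
    calc _ ≤ ∫⁻ g, ENNReal.ofReal (Real.exp (K * ∑ j, s j ^ 2 + 4 * K * ∑ j ∈ J, a j)) *
            ENNReal.ofReal (Real.exp (2 * a i * K * g ^ 2)) ∂(gaussianReal 0 1) := by
          refine lintegral_mono fun g => ?_
          have := ih (Function.update s i (r * g)) fun j hj => by
            rw [Function.update_of_ne (ne_of_mem_of_not_mem hj hi)]
            exact hs j (Finset.mem_insert_of_mem hj)
          simp only [hlin, hsq] at this
          refine this.trans_eq ?_
          rw [← ENNReal.ofReal_mul (Real.exp_pos _).le, ← Real.exp_add]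
          congr 2; ring
      _ ≤ ENNReal.ofReal (Real.exp (K * ∑ j, s j ^ 2 + 4 * K * ∑ j ∈ J, a j)) *
            ENNReal.ofReal (Real.exp (2 * (2 * a i * K))) := by
          rw [lintegral_const_mul _ (by fun_prop)]
          gcongr
          exact lintegral_exp_sq_gaussianReal_le (by have := ha i; positivity)
            (by linarith [haK i])
      _ = _ := by
          rw [← ENNReal.ofReal_mul (Real.exp_pos _).le, ← Real.exp_add, Finset.sum_insert hi]
          congr 2; ring

/-- Converse of `SqExpLE.hasSubgaussianMGF` up to a factor 8 in the exponent: the Gaussian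
linearization with one coordinate, whose bound exp(1/2) is below 2. -/
lemma sqExpLE_of_hasSubgaussianMGF {Y : Ω → ℝ} (hY : Measurable Y) {c : ℝ≥0} (hc : 0 < c)
    (h : HasSubgaussianMGF Y c μ) : SqExpLE μ (1 / (4 * c)) Y := by
  rw [sqExpLE_iff hY]
  have hc' : (0 : ℝ) < c := hc
  have := lintegral_exp_sum_sq_le (ι := Unit) (Y := fun _ => Y) (fun _ => hY) (K := c / 2)
    (by positivity) (fun s => by
      have e : (c : ℝ) * s () ^ 2 / 2 = c / 2 * s () ^ 2 := by ring
      have := lintegral_exp_mul_le_of_hasSubgaussianMGF h (s ())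
      rw [e] at this
      simpa using this)
    (a := fun _ => 1 / (4 * c)) (fun _ => by positivity) (fun _ => by field_simp; norm_num)
  simp only [Finset.univ_unique, Finset.sum_const, Finset.card_singleton, one_smul] at this
  refine this.trans ?_
  have e : 4 * ((c : ℝ) / 2) * (1 / (4 * c)) = 1 / 2 := by field_simp
  rw [e]
  exact ENNReal.ofReal_le_of_le_toReal (by simpa using exp_half_le_two)

end

/-! ### Nets for quadratic forms on the sphere -/

lemma dotProduct_self_eq_norm_sq {ι : Type*} [Fintype ι] (x : EuclideanSpace ℝ ι) :
    x.ofLp ⬝ᵥ x.ofLp = ‖x‖ ^ 2 := by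
  rw [EuclideanSpace.norm_sq_eq]
  simp [dotProduct, sq]

/-- A 1-separated set of largest cardinality is a cover, since an uncovered point could be added to
it. The radius is 2 because `Besicovitch.card_le_of_separated` counts 1-separated points in the ball
of radius 2. -/
lemma exists_separated_cover (E : Type*) [NormedAddCommGroup E] [NormedSpace ℝ E]
    [FiniteDimensional ℝ E] :
    ∃ S : Finset E, S.card ≤ 5 ^ Module.finrank ℝ E ∧ (∀ c ∈ S, ‖c‖ = 2) ∧
      ∀ v : E, ‖v‖ = 2 → ∃ c ∈ S, ‖v - c‖ < 1 := by
  classical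
  let P : ℕ → Prop := fun N => ∃ S : Finset E, S.card = N ∧ (∀ c ∈ S, ‖c‖ = 2) ∧
    ∀ c ∈ S, ∀ d ∈ S, c ≠ d → 1 ≤ ‖c - d‖
  have hP : ∀ N, P N → N ≤ 5 ^ Module.finrank ℝ E := by
    rintro N ⟨S, rfl, h1, h2⟩
    exact Besicovitch.card_le_of_separated S (fun c hc => (h1 c hc).le) h2
  have h0 : P 0 := ⟨∅, by simp⟩
  obtain ⟨S, hS, h1, h2⟩ := Nat.findGreatest_spec (P := P) (Nat.zero_le (5 ^ Module.finrank ℝ E)) h0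
  refine ⟨S, hP _ ⟨S, rfl, h1, h2⟩, h1, fun v hv => ?_⟩
  by_contra! hc
  have hvS : v ∉ S := fun h => by
    have := hc v h
    simp at this
    linarith
  have hP' : P (S.card + 1) := by
    refine ⟨insert v S, Finset.card_insert_of_notMem hvS, ?_, ?_⟩
    · intro c hc'
      rcases Finset.mem_insert.1 hc' with rfl | h
      · exact hv
      · exact h1 c h
    · intro c hc' d hd hne
      rcases Finset.mem_insert.1 hc' with rfl | h <;> rcases Finset.mem_insert.1 hd with rfl | h'
      · exact absurd rfl hne
      · exact hc d h'
      · rw [norm_sub_rev]; exact hc c h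
      · exact h2 c h d h' hne
  have := Nat.le_findGreatest (hP _ hP') hP'
  omega

/-- A finite subset of the unit sphere that controls all quadratic forms on the sphere. -/
lemma exists_quadForm_net (ι : Type*) [Fintype ι] :
    ∃ N : Finset (ι → ℝ), N.card ≤ 5 ^ Fintype.card ι ∧ (∀ u ∈ N, u ⬝ᵥ u = 1) ∧
      ∀ (Q : Matrix ι ι ℝ) (τ : ℝ), (∀ u ∈ N, |u ⬝ᵥ Q *ᵥ u| ≤ τ) →
        ∀ v : ι → ℝ, |v ⬝ᵥ Q *ᵥ v| ≤ 32 * τ * (v ⬝ᵥ v) := by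
  classical
  obtain ⟨S, hS, h1, h2⟩ := exists_separated_cover (EuclideanSpace ℝ ι)
  rw [finrank_euclideanSpace] at hS
  refine ⟨S.image fun c => ((1 / 2 : ℝ) • c).ofLp, Finset.card_image_le.trans hS, ?_, ?_⟩
  · intro u hu
    obtain ⟨c, hc, rfl⟩ := Finset.mem_image.1 hu
    rw [dotProduct_self_eq_norm_sq, norm_smul, h1 c hc]
    norm_num
  intro Q τ hτ v
  let q : EuclideanSpace ℝ ι → ℝ := fun x => x.ofLp ⬝ᵥ Q *ᵥ x.ofLp
  suffices H : ∀ x : EuclideanSpace ℝ ι, |q x| ≤ 32 * τ * ‖x‖ ^ 2 by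
    have := H (WithLp.toLp 2 v)
    rwa [← dotProduct_self_eq_norm_sq] at this
  intro x
  have hq : ∀ (r : ℝ) (x : EuclideanSpace ℝ ι), q (r • x) = r ^ 2 * q x := fun r x => by
    simp only [q, WithLp.ofLp_smul, mulVec_smul, dotProduct_smul, smul_dotProduct, smul_eq_mul]
    ring
  rcases eq_or_ne x 0 with rfl | hx
  · simp [q]
  have hcont : Continuous fun x : EuclideanSpace ℝ ι => |q x| := by
    simp only [q, dotProduct, mulVec]
    fun_prop
  have hx' : 0 < ‖x‖ := norm_pos_iff.2 hx
  have hne : (Metric.sphere (0 : EuclideanSpace ℝ ι) 1).Nonempty :=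
    ⟨(1 / ‖x‖) • x, by simp [norm_smul, hx'.ne']⟩
  obtain ⟨w, hw, hmax⟩ := (isCompact_sphere (0 : EuclideanSpace ℝ ι) 1).exists_isMaxOn hne hcont.continuousOn
  have hle : ∀ y : EuclideanSpace ℝ ι, |q y| ≤ |q w| * ‖y‖ ^ 2 := by
    intro y
    rcases eq_or_ne y 0 with rfl | hy
    · simp [q]
    have hy' : 0 < ‖y‖ := norm_pos_iff.2 hy
    have hmem : (1 / ‖y‖) • y ∈ Metric.sphere (0 : EuclideanSpace ℝ ι) 1 := by simp [norm_smul, hy'.ne']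
    have := hmax hmem
    simp only [Set.mem_ofPred_eq, hq, abs_mul] at this
    rw [abs_of_nonneg (by positivity), div_pow, one_pow, one_div, inv_mul_eq_div,
      div_le_iff₀ (by positivity)] at this
    exact this
  have hw1 : ‖w‖ = 1 := by simpa using hw
  obtain ⟨c, hc, hcw⟩ := h2 ((2 : ℝ) • w) (by rw [norm_smul, hw1]; norm_num)
  set u : EuclideanSpace ℝ ι := (1 / 2 : ℝ) • c with hu
  have hu1 : ‖u‖ = 1 := by rw [hu, norm_smul, h1 c hc]; norm_num
  have hqu : |q u| ≤ τ := hτ _ (Finset.mem_image_of_mem _ hc)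
  have hd : ‖w - u‖ ^ 2 < 1 / 4 := by
    have e : (2 : ℝ) • w - c = (2 : ℝ) • (w - u) := by rw [hu]; module
    rw [e, norm_smul] at hcw
    have : ‖w - u‖ < 1 / 2 := by
      rw [Real.norm_of_nonneg (by norm_num)] at hcw; linarith
    nlinarith [norm_nonneg (w - u)]
  -- The cross terms cancel, so Q need not be symmetric. For a net of mesh 1/2 the two squared norms
  -- add up to at most 31/8 < 4; the maximum |q w| can thus be absorbed on the left, and 4 - 31/8 =
  -- 1/8 produces the factor 32.
  have hid : 4 * q w = 4 * q u + (q ((5 / 2 : ℝ) • w - (3 / 2 : ℝ) • u) -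
      q ((3 / 2 : ℝ) • w - (5 / 2 : ℝ) • u)) := by
    simp only [q, WithLp.ofLp_smul, WithLp.ofLp_sub, mulVec_smul, mulVec_sub, dotProduct_smul,
      smul_dotProduct, dotProduct_sub, sub_dotProduct, smul_eq_mul]
    ring
  have hn1 : ‖(5 / 2 : ℝ) • w - (3 / 2 : ℝ) • u‖ ^ 2 + ‖(3 / 2 : ℝ) • w - (5 / 2 : ℝ) • u‖ ^ 2 ≤
      31 / 8 := by
    rw [@norm_sub_sq_real (EuclideanSpace ℝ ι), @norm_sub_sq_real (EuclideanSpace ℝ ι)]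
    rw [@norm_sub_sq_real (EuclideanSpace ℝ ι), hw1, hu1] at hd
    simp only [norm_smul, inner_smul_left, inner_smul_right, hw1, hu1]
    norm_num at hd ⊢
    linarith
  have h3 := hle ((5 / 2 : ℝ) • w - (3 / 2 : ℝ) • u)
  have h4 := hle ((3 / 2 : ℝ) • w - (5 / 2 : ℝ) • u)
  have h5 : 4 * |q w| ≤ 4 * τ + |q w| * (31 / 8) := by
    have : |4 * q w| ≤ 4 * |q u| + (|q ((5 / 2 : ℝ) • w - (3 / 2 : ℝ) • u)| +
        |q ((3 / 2 : ℝ) • w - (5 / 2 : ℝ) • u)|) := by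
      rw [hid]
      refine (abs_add_le _ _).trans (add_le_add ?_ (abs_sub _ _))
      rw [abs_mul]; norm_num
    rw [abs_mul, abs_of_nonneg (by norm_num : (0 : ℝ) ≤ 4)] at this
    have h6 := mul_le_mul_of_nonneg_left hn1 (abs_nonneg (q w))
    linarith
  refine (hle x).trans ?_
  gcongr
  linarith

/-! ### Union bound over a net, Bernstein and Chernoff inequalities -/

section

variable {Ω : Type*} [MeasurableSpace Ω] {μ : Measure Ω}

lemma measureReal_le_exp_of_lintegral_exp_le {U : Ω → ℝ} (hU : Measurable U) {A : ℝ}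
    (h : ∫⁻ ω, ENNReal.ofReal (Real.exp (U ω)) ∂μ ≤ ENNReal.ofReal (Real.exp A)) (τ : ℝ) :
    μ.real {ω | τ ≤ U ω} ≤ Real.exp (A - τ) := by
  have h1 := mul_meas_ge_le_lintegral (μ := μ) (f := fun ω => ENNReal.ofReal (Real.exp (U ω)))
    (by fun_prop) (ENNReal.ofReal (Real.exp τ))
  have h2 : {ω | τ ≤ U ω} ⊆
      {ω | ENNReal.ofReal (Real.exp τ) ≤ ENNReal.ofReal (Real.exp (U ω))} := fun ω hω =>
    ENNReal.ofReal_le_ofReal (Real.exp_le_exp.2 hω)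
  have h3 : ENNReal.ofReal (Real.exp τ) * μ {ω | τ ≤ U ω} ≤ ENNReal.ofReal (Real.exp A) :=
    (mul_le_mul_right (measure_mono h2) _).trans (h1.trans h)
  refine ENNReal.toReal_le_of_le_ofReal (Real.exp_pos _).le ?_
  rw [Real.exp_sub, ENNReal.ofReal_div_of_pos (Real.exp_pos _), ENNReal.le_div_iff_mul_le
    (Or.inl (by simp [Real.exp_pos])) (Or.inl ENNReal.ofReal_ne_top), mul_comm]
  exact h3

variable [IsProbabilityMeasure μ]

/-- Union bound over the net for a random quadratic form. -/
lemma measureReal_quadForm_le {ι : Type*} [Fintype ι] (Q : Ω → Matrix ι ι ℝ) {τ δ : ℝ} (hδ : 0 ≤ δ)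
    (h : ∀ u : ι → ℝ, u ⬝ᵥ u = 1 → μ.real {ω | τ ≤ |u ⬝ᵥ Q ω *ᵥ u|} ≤ δ) :
    μ.real {ω | ¬ ∀ v : ι → ℝ, |v ⬝ᵥ Q ω *ᵥ v| ≤ 32 * τ * (v ⬝ᵥ v)} ≤
      5 ^ Fintype.card ι * δ := by
  obtain ⟨N, hN, hN1, hNQ⟩ := exists_quadForm_net ι
  have hsub : {ω | ¬ ∀ v : ι → ℝ, |v ⬝ᵥ Q ω *ᵥ v| ≤ 32 * τ * (v ⬝ᵥ v)} ⊆
      ⋃ u ∈ N, {ω | τ ≤ |u ⬝ᵥ Q ω *ᵥ u|} := by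
    intro ω hω
    by_contra hc
    simp only [Set.mem_iUnion, not_exists] at hc
    exact hω (hNQ (Q ω) τ fun u hu => (not_le.1 (hc u hu)).le)
  refine (measureReal_mono hsub (measure_ne_top _ _)).trans ((measureReal_biUnion_finset_le N _).trans ?_)
  calc _ ≤ ∑ u ∈ N, δ := Finset.sum_le_sum fun u hu => h u (hN1 u hu)
    _ = N.card * δ := by simp
    _ ≤ _ := by
      gcongr
      exact_mod_cast hN

/-- Bernstein's inequality for a weighted sum of centered squares of independent variables. -/
lemma measureReal_abs_sum_sq_sub_one_ge_le {ι : Type*} [Fintype ι] {Y : ι → Ω → ℝ}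
    (hY : ∀ j, Measurable (Y j)) (hi : iIndepFun Y μ) {b : ℝ} (hb : 0 < b)
    (h : ∀ j, SqExpLE μ b (Y j)) (h1 : ∀ j, ∫ ω, Y j ω ^ 2 ∂μ = 1)
    {w : ι → ℝ} {L : ℝ} (hw : ∀ j, 0 ≤ w j) (hL : ∀ j, w j ≤ L)
    {s : ℝ} (hs0 : 0 ≤ s) (hs : s * L ≤ b / 4) (τ : ℝ) :
    μ.real {ω | τ ≤ |∑ j, w j * (Y j ω ^ 2 - 1)|} ≤
      2 * Real.exp (-s * τ + 128 * s ^ 2 * (∑ j, w j ^ 2) / b ^ 2) := by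
  have hi' : iIndepFun (fun j ω => w j * (Y j ω ^ 2 - 1)) μ :=
    hi.comp (fun j x => w j * (x ^ 2 - 1)) fun j => by fun_prop
  have key : ∀ r : ℝ, |r| ≤ s →
      Integrable (fun ω => Real.exp (r * (∑ j, fun ω => w j * (Y j ω ^ 2 - 1)) ω)) μ ∧
      mgf (∑ j, fun ω => w j * (Y j ω ^ 2 - 1)) μ r ≤
        Real.exp (128 * s ^ 2 * (∑ j, w j ^ 2) / b ^ 2) := by
    intro r hr
    have hrw : ∀ j, |r * w j| ≤ b / 4 := fun j => by
      rw [abs_mul, abs_of_nonneg (hw j)]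
      refine le_trans ?_ hs
      exact mul_le_mul hr (hL j) (hw j) hs0
    have hj := fun j => (h j).mgf_sq_sub_le hb (hY j) (h1 j) (hrw j)
    have hmgf : ∀ j, mgf (fun ω => w j * (Y j ω ^ 2 - 1)) μ r =
        mgf (fun ω => Y j ω ^ 2 - 1) μ (r * w j) := fun j => by
      simp only [mgf, mul_assoc]
    refine ⟨?_, ?_⟩
    · have := hi'.integrable_exp_mul_sum (t := r) (fun j => by fun_prop) (s := Finset.univ)
        fun j _ => by simpa only [mul_assoc] using (hj j).1
      exact this
    · rw [hi'.mgf_sum (fun j => by fun_prop)]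
      calc _ ≤ ∏ j, Real.exp (128 * (s * w j) ^ 2 / b ^ 2) := by
            refine Finset.prod_le_prod (fun j _ => mgf_nonneg) fun j _ => ?_
            rw [hmgf]
            refine (hj j).2.trans (Real.exp_le_exp.2 ?_)
            have : (r * w j) ^ 2 ≤ (s * w j) ^ 2 := by
              rw [mul_pow, mul_pow, ← sq_abs r]
              gcongr
            gcongr
        _ = _ := by
            rw [← Real.exp_sum]
            congr 1
            rw [Finset.mul_sum, Finset.sum_div]
            exact Finset.sum_congr rfl fun j _ => by ring
  have hsplit : {ω | τ ≤ |∑ j, w j * (Y j ω ^ 2 - 1)|} ⊆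
      {ω | τ ≤ (∑ j, fun ω => w j * (Y j ω ^ 2 - 1)) ω} ∪
      {ω | (∑ j, fun ω => w j * (Y j ω ^ 2 - 1)) ω ≤ -τ} := by
    intro ω hω
    simp only [Set.mem_union, Set.mem_ofPred_eq, Finset.sum_apply] at hω ⊢
    rcases le_abs.1 hω with h | h
    · exact Or.inl h
    · exact Or.inr (by linarith)
  refine (measureReal_mono hsplit).trans ((measureReal_union_le _ _).trans ?_)
  have hp := key s (abs_of_nonneg hs0).le
  have hm := key (-s) (by rw [abs_neg, abs_of_nonneg hs0])
  have t1 := measure_ge_le_exp_mul_mgf (μ := μ) τ hs0 hp.1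
  have t2 := measure_le_le_exp_mul_mgf (μ := μ) (-τ) (neg_nonpos.2 hs0) hm.1
  rw [Real.exp_add]
  have e1 : -(-s) * -τ = -s * τ := by ring
  rw [e1] at t2
  have p := (Real.exp_pos (-s * τ)).le
  have u1 := mul_le_mul_of_nonneg_left hp.2 p
  have u2 := mul_le_mul_of_nonneg_left hm.2 p
  linarith

/-- Chernoff's inequality for a sum of independent variables with bounded exponential moments. -/
lemma measureReal_sum_ge_le {n : ℕ} {U : Fin n → Ω → ℝ} (hU : ∀ i, Measurable (U i))
    (hi : iIndepFun U μ) {b : ℝ} (hb : 0 < b)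
    (h : ∀ i, Integrable (fun ω => Real.exp (b * U i ω)) μ ∧ ∫ ω, Real.exp (b * U i ω) ∂μ ≤ 2) :
    μ.real {ω | 2 * n / b ≤ ∑ i, U i ω} ≤ Real.exp (-n) := by
  have hint := hi.integrable_exp_mul_sum (t := b) hU (s := Finset.univ) fun i _ => (h i).1
  have t1 := measure_ge_le_exp_mul_mgf (μ := μ) (2 * n / b) hb.le hint
  simp only [Finset.sum_apply] at t1
  refine t1.trans ?_
  rw [hi.mgf_sum hU]
  -- One factor exp(-n) pays for the product 2^n of the moments, since 2 < e; the other is the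
  -- bound.
  have e : -b * (2 * n / b) = -n + -n := by field_simp; ring
  rw [e, Real.exp_add, mul_assoc]
  refine mul_le_of_le_one_right (Real.exp_pos _).le ?_
  calc Real.exp (-n) * ∏ i, mgf (U i) μ b ≤ Real.exp (-n) * ∏ _i : Fin n, 2 := by
        gcongr with i
        · exact fun i _ => mgf_nonneg
        · exact (h i).2
    _ = (Real.exp (-1) * 2) ^ n := by
        rw [mul_pow, ← Real.exp_nat_mul]; simp
    _ ≤ 1 := by
        refine pow_le_one₀ (by positivity) ?_
        rw [Real.exp_neg, inv_mul_le_iff₀ (Real.exp_pos _)]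
        linarith [Real.exp_one_gt_d9]

end

/-! ### Isotropic sub-Gaussian designs -/

section

variable {Ω : Type*} [MeasurableSpace Ω] {μ : Measure Ω}

/-- The joint law of all entries is a product measure, and currying carries a product over pairs to
a product of products. -/
lemma iIndepFun_curry {ι κ : Type*} {X : ι → κ → Ω → ℝ} (mX : ∀ i j, Measurable (X i j))
    (h : iIndepFun (fun (q : (_ : ι) × κ) ω => X q.1 q.2 ω) μ) :
    iIndepFun (fun i ω j => X i j ω) μ := by
  have := h.isProbabilityMeasure
  have : ∀ i j, IsProbabilityMeasure (μ.map (X i j)) :=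
    fun i j => Measure.isProbabilityMeasure_map (mX i j).aemeasurable
  have hcur : (MeasurableEquiv.piCurry fun (_ : ι) (_ : κ) => ℝ) ∘
      (fun ω q => X q.1 q.2 ω) = fun ω i j => X i j ω := by
    ext; simp [Sigma.curry]
  have hrow : ∀ i, iIndepFun (X i) μ := fun i =>
    h.precomp (g := fun j => ⟨i, j⟩) fun j j' e => by simpa using e
  rw [iIndepFun_iff_map_fun_eq_infinitePi_map (by fun_prop), ← hcur,
    ← Measure.map_map (by fun_prop) (by fun_prop), h.map_fun_eq_infinitePi_map (by fun_prop),
    Measure.infinitePi_map_piCurry (fun i j => μ.map (X i j))]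
  congr 1
  ext1 i
  rw [(hrow i).map_fun_eq_infinitePi_map (mX i)]

/-- If the rows of a random matrix are independent and so are the entries of each row, then
the columns are independent. -/
lemma iIndepFun_columns {ι κ : Type*} {X : ι → κ → Ω → ℝ} (mX : ∀ i j, Measurable (X i j))
    (h1 : iIndepFun (fun i ω j => X i j ω) μ) (h2 : ∀ i, iIndepFun (X i) μ) :
    iIndepFun (fun j ω i => X i j ω) μ :=
  iIndepFun_curry (X := fun j i => X i j) (fun j i => mX i j)
    ((iIndepFun_uncurry' mX h1 h2).precomp (g := fun q : (_ : κ) × ι => (q.2, q.1)) (by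
      rintro ⟨a, b⟩ ⟨c, d⟩ e
      simp only [Prod.mk.injEq] at e
      obtain ⟨rfl, rfl⟩ := e
      rfl))

/-- A random matrix with independent, centered, isotropic, sub-Gaussian rows. -/
structure IsoDesign (μ : Measure Ω) {ι κ : Type*} [Fintype κ] (b : ℝ) (Z : ι → κ → Ω → ℝ) :
    Prop where
  measurable : ∀ i j, Measurable (Z i j)
  indep : iIndepFun (fun i ω j => Z i j ω) μ
  centered : ∀ i j, ∫ ω, Z i j ω ∂μ = 0
  isotropic : ∀ i (s : κ → ℝ), ∫ ω, (∑ j, s j * Z i j ω) ^ 2 ∂μ = s ⬝ᵥ s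
  sqExp : ∀ i (s : κ → ℝ), s ⬝ᵥ s = 1 → SqExpLE μ b fun ω => ∑ j, s j * Z i j ω

namespace IsoDesign

variable {ι κ : Type*} [Fintype κ] {b : ℝ} {Z : ι → κ → Ω → ℝ}

/-- A direction on the subset of columns extends by zero without changing its length or its linear
form. Head and tail therefore inherit every property of the design. -/
lemma restrict (h : IsoDesign μ b Z) (P : κ → Prop) [DecidablePred P] :
    IsoDesign μ b fun i (j : {j // P j}) => Z i j := by
  have hext : ∀ (s : {j // P j} → ℝ), ∃ s' : κ → ℝ, s' ⬝ᵥ s' = s ⬝ᵥ s ∧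
      ∀ i ω, ∑ j, s' j * Z i j ω = ∑ j : {j // P j}, s j * Z i j ω := by
    intro s
    have key : ∀ f : κ → ℝ, ∑ j, (if hj : P j then s ⟨j, hj⟩ else 0) * f j =
        ∑ j : {j // P j}, s j * f j := by
      intro f
      rw [← Fintype.sum_subtype_add_sum_subtype P]
      have h0 : ∑ j : {j // ¬ P j}, (if hj : P j then s ⟨j, hj⟩ else 0) * f j = 0 :=
        Finset.sum_eq_zero fun j _ => by simp [j.2]
      rw [h0, add_zero]
      exact Finset.sum_congr rfl fun j _ => by simp [j.2]
    refine ⟨fun j => if hj : P j then s ⟨j, hj⟩ else 0, ?_, fun i ω => key fun j => Z i j ω⟩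
    rw [dotProduct, key]
    exact Finset.sum_congr rfl fun j _ => by simp [j.2]
  refine ⟨fun i j => h.measurable i j,
    h.indep.comp (fun _ x (j : {j // P j}) => x j) fun i => by fun_prop,
    fun i j => h.centered i j, fun i s => ?_, fun i s hs => ?_⟩
  · obtain ⟨s', h1, h2⟩ := hext s
    simp_rw [← h2, ← h1]
    exact h.isotropic i s'
  · obtain ⟨s', h1, h2⟩ := hext s
    simp_rw [← h2]
    exact h.sqExp i s' (h1.trans hs)

lemma memLp (h : IsoDesign μ b Z) (hb : 0 < b) (i : ι) (j : κ) : MemLp (Z i j) 2 μ := by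
  classical
  have := (h.sqExp i (Pi.single j 1) (by simp)).memLp_two hb (by
    have := h.measurable; fun_prop)
  simpa [Pi.single_apply] using this

variable [IsProbabilityMeasure μ]

lemma integral_row (h : IsoDesign μ b Z) (hb : 0 < b) (i : ι) (s : κ → ℝ) :
    ∫ ω, ∑ j, s j * Z i j ω ∂μ = 0 := by
  rw [integral_finsetSum _ fun j _ => ((h.memLp hb i j).integrable (by norm_num)).const_mul _]
  simp [integral_const_mul, h.centered]

lemma hasSubgaussianMGF_row (h : IsoDesign μ b Z) (hb : 0 < b) (i : ι) (s : κ → ℝ) :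
    HasSubgaussianMGF (fun ω => ∑ j, s j * Z i j ω) (2 / b * (s ⬝ᵥ s)).toNNReal μ := by
  have hss : 0 ≤ s ⬝ᵥ s := Finset.sum_nonneg fun j _ => mul_self_nonneg _
  rcases hss.eq_or_lt with h0 | h0
  · have hs : s = 0 := dotProduct_self_eq_zero.1 h0.symm
    simp [hs]
  set r := √(s ⬝ᵥ s)
  have hr : 0 < r := Real.sqrt_pos.2 h0
  have hr2 : r ^ 2 = s ⬝ᵥ s := Real.sq_sqrt hss
  have hu : ((1 / r) • s) ⬝ᵥ ((1 / r) • s) = 1 := by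
    rw [smul_dotProduct, dotProduct_smul, ← hr2]
    simp only [smul_eq_mul]
    field_simp
  have hm : Measurable fun ω => ∑ j, ((1 / r) • s) j * Z i j ω := by
    have := h.measurable; fun_prop
  have := ((h.sqExp i _ hu).hasSubgaussianMGF hb hm (h.integral_row hb i _)).const_mul r
  have e : (fun ω => r * ∑ j, ((1 / r) • s) j * Z i j ω) = fun ω => ∑ j, s j * Z i j ω := by
    ext ω
    rw [Finset.mul_sum]
    refine Finset.sum_congr rfl fun j _ => ?_
    simp only [Pi.smul_apply, smul_eq_mul]
    field_simp
  rw [e] at this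
  refine ⟨this.integrable_exp_mul, fun t => (this.mgf_le t).trans_eq ?_⟩
  change Real.exp (r ^ 2 * ((2 / b).toNNReal : ℝ) * t ^ 2 / 2) = _
  rw [Real.coe_toNNReal _ (by positivity), Real.coe_toNNReal _ (by positivity), ← hr2]
  congr 1; ring

variable [Fintype ι]

/-- The form is a combination of independent row variables with coefficients u. Hence Zᵀu is a
sub-Gaussian vector with the proxy of one row, although its coordinates may be dependent. -/
lemma hasSubgaussianMGF_bilin (h : IsoDesign μ b Z) (hb : 0 < b) {u : ι → ℝ} (hu : u ⬝ᵥ u = 1)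
    (s : κ → ℝ) :
    HasSubgaussianMGF (fun ω => ∑ j, s j * ∑ i, u i * Z i j ω) (2 / b * (s ⬝ᵥ s)).toNNReal μ := by
  have hind : iIndepFun (fun i ω => ∑ j, s j * Z i j ω) μ :=
    h.indep.comp (fun _ x => ∑ j, s j * x j) fun i => by fun_prop
  have := hasSubgaussianMGF_sum_mul hind (fun i => h.hasSubgaussianMGF_row hb i s) u (s := 1)
    (by rw [NNReal.coe_one, ← hu, dotProduct]; simp only [sq])
  rw [one_mul] at this
  convert this using 2 with ω
  simp_rw [Finset.mul_sum]
  rw [Finset.sum_comm]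
  exact Finset.sum_congr rfl fun i _ => Finset.sum_congr rfl fun j _ => by ring

lemma sqExpLE_column (h : IsoDesign μ b Z) (hb : 0 < b) {u : ι → ℝ} (hu : u ⬝ᵥ u = 1) (j : κ) :
    SqExpLE μ (b / 8) fun ω => ∑ i, u i * Z i j ω := by
  classical
  have hs := h.hasSubgaussianMGF_bilin hb hu (Pi.single j 1)
  simp only [Pi.single_apply, ite_mul, one_mul, zero_mul, Finset.sum_ite_eq', Finset.mem_univ,
    if_true, dotProduct_single, mul_one] at hs
  have hm : Measurable fun ω => ∑ i, u i * Z i j ω := by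
    have := h.measurable; fun_prop
  have := sqExpLE_of_hasSubgaussianMGF hm (by rw [Real.toNNReal_pos]; positivity) hs
  rw [Real.coe_toNNReal _ (by positivity)] at this
  convert this using 1
  field_simp
  norm_num

lemma integral_column_sq (h : IsoDesign μ b Z) (hb : 0 < b) {u : ι → ℝ} (hu : u ⬝ᵥ u = 1)
    (j : κ) : ∫ ω, (∑ i, u i * Z i j ω) ^ 2 ∂μ = 1 := by
  classical
  have hmeas := h.measurable
  have hmem : ∀ i, MemLp (fun ω => u i * Z i j ω) 2 μ := fun i => (h.memLp hb i j).const_mul _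
  have hz : ∀ i, ∫ ω, u i * Z i j ω ∂μ = 0 := fun i => by
    rw [integral_const_mul, h.centered, mul_zero]
  have hind : iIndepFun (fun i ω => u i * Z i j ω) μ :=
    h.indep.comp (fun i x => u i * x j) fun i => by fun_prop
  have hv := IndepFun.variance_sum (s := Finset.univ) (fun i _ => hmem i)
    fun i _ i' _ hne => hind.indepFun hne
  rw [variance_of_integral_eq_zero (Measurable.aemeasurable (by fun_prop)) (by
    simp only [Finset.sum_apply]
    rw [integral_finsetSum _ fun i _ => (hmem i).integrable (by norm_num)]
    simp [hz])] at hv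
  simp only [Finset.sum_apply] at hv
  rw [hv, ← hu]
  refine Finset.sum_congr rfl fun i _ => ?_
  rw [variance_of_integral_eq_zero (Measurable.aemeasurable (by fun_prop)) (hz i)]
  simp_rw [mul_pow]
  have := h.isotropic i (Pi.single j 1)
  simp only [Pi.single_apply, ite_mul, one_mul, zero_mul, Finset.sum_ite_eq', Finset.mem_univ,
    if_true, dotProduct_single, mul_one] at this
  rw [integral_const_mul, this]
  ring

end IsoDesign

end

/-! ### Concentration of Gram matrices -/

section

variable {Ω : Type*} [MeasurableSpace Ω] {μ : Measure Ω}

/-- The Gram matrix `∑ⱼ wⱼ zⱼ zⱼᵀ` of the weighted columns. -/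
def colGram {ι κ : Type*} [Fintype κ] (w : κ → ℝ) (Z : Matrix ι κ ℝ) : Matrix ι ι ℝ :=
  of fun i i' => ∑ j, w j * (Z i j * Z i' j)

lemma quadForm_colGram {ι κ : Type*} [Fintype ι] [Fintype κ] (w : κ → ℝ) (Z : Matrix ι κ ℝ)
    (v : ι → ℝ) :
    v ⬝ᵥ colGram w Z *ᵥ v = ∑ j, w j * (∑ i, v i * Z i j) ^ 2 := by
  simp only [dotProduct, mulVec, colGram, of_apply, Finset.mul_sum, Finset.sum_mul, sq]
  rw [Finset.sum_comm]
  conv_lhs =>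
    enter [2, i]
    rw [Finset.sum_comm]
  rw [Finset.sum_comm]
  refine Finset.sum_congr rfl fun j _ => ?_
  rw [Finset.sum_comm]
  refine Finset.sum_congr rfl fun i _ => Finset.sum_congr rfl fun i' _ => by ring

/-- Since 5 < e², a tail exp(-3n) in each direction survives the union over the 5^n net points. -/
lemma five_pow_mul_exp_le (n : ℕ) : (5 : ℝ) ^ n * Real.exp (-(3 * n)) ≤ Real.exp (-n) := by
  have h5 : (5 : ℝ) ≤ Real.exp 2 := by
    have e : Real.exp 2 = Real.exp 1 ^ 2 := by rw [← Real.exp_nat_mul]; norm_num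
    rw [e]
    nlinarith [Real.exp_one_gt_d9]
  calc (5 : ℝ) ^ n * Real.exp (-(3 * n)) ≤ Real.exp 2 ^ n * Real.exp (-(3 * n)) := by gcongr
    _ = _ := by rw [← Real.exp_nat_mul, ← Real.exp_add]; congr 1; ring

/-- Convexity: a weighted mean of squares inherits the exponential moment bound. -/
lemma integral_exp_convex_sq_le {κ : Type*} [Fintype κ] {Y : κ → Ω → ℝ} {b : ℝ}
    (hY : ∀ j, Measurable (Y j)) (h : ∀ j, SqExpLE μ b (Y j)) {a : κ → ℝ} (ha : ∀ j, 0 ≤ a j)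
    (ha1 : ∑ j, a j = 1) :
    Integrable (fun ω => Real.exp (b * ∑ j, a j * Y j ω ^ 2)) μ ∧
      ∫ ω, Real.exp (b * ∑ j, a j * Y j ω ^ 2) ∂μ ≤ 2 := by
  have hI : Integrable (fun ω => ∑ j, a j * Real.exp (b * Y j ω ^ 2)) μ :=
    integrable_finsetSum _ fun j _ => (h j).1.const_mul _
  have hp : ∀ ω, Real.exp (b * ∑ j, a j * Y j ω ^ 2) ≤
      ∑ j, a j * Real.exp (b * Y j ω ^ 2) := by
    intro ω
    have := convexOn_exp.map_sum_le (t := Finset.univ) (w := a) (p := fun j => b * Y j ω ^ 2)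
      (fun j _ => ha j) ha1 (fun j _ => Set.mem_univ _)
    simp only [smul_eq_mul] at this
    refine le_of_eq_of_le ?_ this
    rw [Finset.mul_sum]
    congr 1
    exact Finset.sum_congr rfl fun j _ => by ring
  have hi : Integrable (fun ω => Real.exp (b * ∑ j, a j * Y j ω ^ 2)) μ :=
    hI.mono' (by fun_prop) (ae_of_all _ fun ω => by
      rw [Real.norm_of_nonneg (Real.exp_pos _).le]; exact hp ω)
  refine ⟨hi, (integral_mono hi hI hp).trans ?_⟩
  rw [integral_finsetSum _ fun j _ => (h j).1.const_mul _]
  calc ∑ j, ∫ ω, a j * Real.exp (b * Y j ω ^ 2) ∂μ ≤ ∑ j, a j * 2 := by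
        refine Finset.sum_le_sum fun j _ => ?_
        rw [integral_const_mul]
        exact mul_le_mul_of_nonneg_left (h j).2 (ha j)
    _ = 2 := by rw [← Finset.sum_mul, ha1, one_mul]

variable [IsProbabilityMeasure μ]

namespace IsoDesign

variable {n : ℕ} {κ : Type*} [Fintype κ] {b : ℝ} {Z : Fin n → κ → Ω → ℝ}

/-- The empirical covariance of an isotropic design is close to the identity. -/
lemma measureReal_empirical_le (h : IsoDesign μ b Z) (hb : 0 < b) (hb1 : b ≤ 1) :
    μ.real {ω | ¬ ∀ v : κ → ℝ, |∑ i, (∑ j, v j * Z i j ω) ^ 2 - n * (v ⬝ᵥ v)| ≤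
      n / 2 * (v ⬝ᵥ v)} ≤ 5 ^ Fintype.card κ * (2 * Real.exp (-(b ^ 2 / 2 ^ 21 * n))) := by
  classical
  have hQ : ∀ ω (v : κ → ℝ), v ⬝ᵥ (colGram (fun _ => 1) (of fun j (i : Fin n) => Z i j ω) -
      (n : ℝ) • (1 : Matrix κ κ ℝ)) *ᵥ v = ∑ i, (∑ j, v j * Z i j ω) ^ 2 - n * (v ⬝ᵥ v) := by
    intro ω v
    rw [sub_mulVec, dotProduct_sub, quadForm_colGram, smul_mulVec, one_mulVec, dotProduct_smul]
    simp
  have := measureReal_quadForm_le (μ := μ)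
    (fun ω => colGram (fun _ => 1) (of fun j (i : Fin n) => Z i j ω) - (n : ℝ) • (1 : Matrix κ κ ℝ))
    (τ := n / 64) (δ := 2 * Real.exp (-(b ^ 2 / 2 ^ 21 * n))) (by positivity) (by
      intro u hu
      simp only [hQ, hu]
      have hm : ∀ i, Measurable fun ω => ∑ j, u j * Z i j ω := fun i => by
        have := h.measurable; fun_prop
      -- The level n/64 becomes n/2 after the factor 32 of the net; s = b²/2¹⁴ minimizes the
      -- Bernstein exponent at this level.
      have hs := measureReal_abs_sum_sq_sub_one_ge_le (Y := fun i ω => ∑ j, u j * Z i j ω)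
        hm (h.indep.comp (fun _ x => ∑ j, u j * x j) fun i => by fun_prop) hb
        (fun i => h.sqExp i u hu) (fun i => (h.isotropic i u).trans hu)
        (w := fun _ => 1) (L := 1) (fun _ => by norm_num) (fun _ => le_rfl)
        (s := b ^ 2 / 2 ^ 14) (by positivity) (by norm_num; nlinarith) (n / 64)
      simp only [one_mul, Finset.sum_sub_distrib, Finset.sum_const, Finset.card_univ,
        Fintype.card_fin, nsmul_eq_mul, mul_one, one_pow] at hs ⊢
      refine hs.trans_eq ?_
      congr 2
      field_simp
      ring)
  simp only [hQ] at this
  convert this using 8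
  ring

/-- Upper bound for the weighted Gram matrix of the columns. -/
lemma measureReal_colGram_le (h : IsoDesign μ b Z) (hb : 0 < b) {w : κ → ℝ} {L : ℝ}
    (hw : ∀ j, 0 ≤ w j) (hL : ∀ j, w j ≤ L) (hL0 : 0 < L) :
    μ.real {ω | ¬ ∀ v : Fin n → ℝ, ∑ j, w j * (∑ i, v i * Z i j ω) ^ 2 ≤
      768 / b * (∑ j, w j + n * L) * (v ⬝ᵥ v)} ≤ Real.exp (-n) := by
  have hmeas := h.measurable
  have hW : 0 ≤ ∑ j, w j := Finset.sum_nonneg fun j _ => hw j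
  have := measureReal_quadForm_le (μ := μ) (fun ω => colGram w (of fun i j => Z i j ω))
    (τ := 24 / b * (∑ j, w j + n * L)) (δ := Real.exp (-(3 * n))) (Real.exp_pos _).le (by
      intro u hu
      -- Scaling by b/(8L) makes the weights as large as the Gaussian linearization with K = 1/b
      -- allows.
      have hsub : {ω | 24 / b * (∑ j, w j + n * L) ≤
          |u ⬝ᵥ colGram w (of fun i j => Z i j ω) *ᵥ u|} ⊆
          {ω | b / (8 * L) * (24 / b * (∑ j, w j + n * L)) ≤
            ∑ j, b / (8 * L) * w j * (∑ i, u i * Z i j ω) ^ 2} := by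
        intro ω hω
        simp only [Set.mem_ofPred_eq, quadForm_colGram, of_apply] at hω ⊢
        rw [abs_of_nonneg (Finset.sum_nonneg fun j _ => mul_nonneg (hw j) (sq_nonneg _))] at hω
        simp_rw [mul_assoc (b / (8 * L)), ← Finset.mul_sum]
        exact mul_le_mul_of_nonneg_left hω (by positivity)
      refine (measureReal_mono hsub).trans ?_
      refine (measureReal_le_exp_of_lintegral_exp_le (by fun_prop)
        (lintegral_exp_sum_sq_le (K := 1 / b) (Y := fun j ω => ∑ i, u i * Z i j ω)
          (fun j => by fun_prop) (by positivity) (fun s => ?_)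
          (fun j => mul_nonneg (by positivity) (hw j)) (fun j => ?_)) _).trans
        (Real.exp_le_exp.2 ?_)
      · have := lintegral_exp_mul_le_of_hasSubgaussianMGF (h.hasSubgaussianMGF_bilin hb hu s) 1
        simp only [one_mul] at this
        refine this.trans_eq ?_
        have hss : 0 ≤ s ⬝ᵥ s := Finset.sum_nonneg fun j _ => mul_self_nonneg _
        rw [Real.coe_toNNReal _ (by positivity)]
        simp only [dotProduct, sq]
        congr 2; ring
      · have e : 8 * (b / (8 * L) * w j * (1 / b)) = w j / L := by field_simp
        rw [e, div_le_one hL0]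
        exact hL j
      · rw [← Finset.mul_sum]
        have e : 4 * (1 / b) * (b / (8 * L) * ∑ j, w j) -
          b / (8 * L) * (24 / b * (∑ j, w j + n * L)) =
          -(3 * n) - 5 / 2 * (∑ j, w j) / L := by field_simp; ring
        rw [e]
        have : 0 ≤ 5 / 2 * (∑ j, w j) / L := by positivity
        linarith)
  rw [Fintype.card_fin] at this
  refine (measureReal_mono ?_).trans (this.trans (five_pow_mul_exp_le n))
  intro ω hω hc
  refine hω fun v => ?_
  have := hc v
  rw [quadForm_colGram] at this
  refine (le_abs_self _).trans (this.trans_eq ?_)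
  ring

/-- For independent columns the weighted Gram matrix is close to a multiple of the identity. -/
lemma measureReal_colGram_sub_le (h : IsoDesign μ b Z) (hb : 0 < b)
    (hcol : ∀ i, iIndepFun (Z i) μ) {w : κ → ℝ} {L : ℝ} (hn : 0 < n)
    (hw : ∀ j, 0 ≤ w j) (hL : ∀ j, w j ≤ L) (hL0 : 0 < L) :
    μ.real {ω | ¬ ∀ v : Fin n → ℝ,
      |∑ j, w j * (∑ i, v i * Z i j ω) ^ 2 - (∑ j, w j) * (v ⬝ᵥ v)| ≤
      11264 / b * (n * L + √(n * ∑ j, w j ^ 2)) * (v ⬝ᵥ v)} ≤ 2 * Real.exp (-n) := by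
  classical
  have hmeas := h.measurable
  set D := n * L + √(n * ∑ j, w j ^ 2) with hD
  have hn' : (0 : ℝ) < n := Nat.cast_pos.2 hn
  have hDn : n * L ≤ D := le_add_of_nonneg_right (Real.sqrt_nonneg _)
  have hD0 : 0 < D := lt_of_lt_of_le (by positivity) hDn
  have hDs : n * ∑ j, w j ^ 2 ≤ D ^ 2 := by
    have hs : 0 ≤ n * ∑ j, w j ^ 2 := by positivity
    calc n * ∑ j, w j ^ 2 = √(n * ∑ j, w j ^ 2) ^ 2 := (Real.sq_sqrt hs).symm
      _ ≤ D ^ 2 := by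
        gcongr
        rw [hD]
        linarith [show 0 < n * L by positivity]
  have hQ : ∀ ω (v : Fin n → ℝ), v ⬝ᵥ (colGram w (of fun i j => Z i j ω) -
      (∑ j, w j) • (1 : Matrix (Fin n) (Fin n) ℝ)) *ᵥ v =
        ∑ j, w j * (∑ i, v i * Z i j ω) ^ 2 - (∑ j, w j) * (v ⬝ᵥ v) := by
    intro ω v
    rw [sub_mulVec, dotProduct_sub, quadForm_colGram, smul_mulVec, one_mulVec, dotProduct_smul]
    simp
  have := measureReal_quadForm_le (μ := μ)
    (fun ω => colGram w (of fun i j => Z i j ω) - (∑ j, w j) • (1 : Matrix (Fin n) (Fin n) ℝ))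
    (τ := 352 / b * D) (δ := 2 * Real.exp (-(3 * n))) (by positivity) (by
      intro u hu
      simp only [hQ, hu]
      -- Independent columns make the coordinates of Zᵀu independent, so Bernstein applies across
      -- columns. With s = bn/(32D) the linear term is -11n and the quadratic one at most 8n, which
      -- leaves the -3n needed for the net.
      have hs := measureReal_abs_sum_sq_sub_one_ge_le (Y := fun j ω => ∑ i, u i * Z i j ω)
        (fun j => by fun_prop)
        ((iIndepFun_columns hmeas h.indep hcol).comp (fun _ x => ∑ i, u i * x i)
          fun j => by fun_prop) (b := b / 8) (by positivity)
        (fun j => h.sqExpLE_column hb hu j) (fun j => h.integral_column_sq hb hu j) hw hL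
        (s := b / 8 * n / (4 * D)) (by positivity) (by
          rw [div_mul_eq_mul_div, div_le_div_iff₀ (by positivity) (by norm_num)]
          nlinarith) (352 / b * D)
      simp only [mul_sub, mul_one, Finset.sum_sub_distrib] at hs ⊢
      refine hs.trans ?_
      gcongr
      have e1 : -(b / 8 * n / (4 * D)) * (352 / b * D) = -(11 * n) := by field_simp; norm_num
      have e2 : 128 * (b / 8 * n / (4 * D)) ^ 2 * (∑ j, w j ^ 2) / (b / 8) ^ 2 =
          8 * n * ((n * ∑ j, w j ^ 2) / D ^ 2) := by field_simp; norm_num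
      rw [e1, e2]
      have : (n * ∑ j, w j ^ 2) / D ^ 2 ≤ 1 := (div_le_one (by positivity)).2 hDs
      nlinarith)
  rw [Fintype.card_fin] at this
  simp only [hQ] at this
  have e : 32 * (352 / b * D) = 11264 / b * D := by ring
  simp only [e] at this
  refine this.trans ?_
  have := five_pow_mul_exp_le n
  linarith

lemma measureReal_sum_sq_row_le (h : IsoDesign μ b Z) (hb : 0 < b) (s : κ → ℝ) :
    μ.real {ω | ¬ ∑ i, (∑ j, s j * Z i j ω) ^ 2 ≤ 2 * n / b * (s ⬝ᵥ s)} ≤ Real.exp (-n) := by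
  have hmeas := h.measurable
  have hss : 0 ≤ s ⬝ᵥ s := Finset.sum_nonneg fun j _ => mul_self_nonneg _
  rcases hss.eq_or_lt with h0 | h0
  · have hs : s = 0 := dotProduct_self_eq_zero.1 h0.symm
    simp [hs, Real.exp_nonneg]
  set r := √(s ⬝ᵥ s)
  have hr : 0 < r := Real.sqrt_pos.2 h0
  have hr2 : r ^ 2 = s ⬝ᵥ s := Real.sq_sqrt hss
  have hu : ((1 / r) • s) ⬝ᵥ ((1 / r) • s) = 1 := by
    rw [smul_dotProduct, dotProduct_smul, ← hr2]
    simp only [smul_eq_mul]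
    field_simp
  have := measureReal_sum_ge_le (μ := μ)
    (U := fun i ω => (∑ j, ((1 / r) • s) j * Z i j ω) ^ 2) (fun i => by fun_prop)
    (h.indep.comp (fun _ x => (∑ j, ((1 / r) • s) j * x j) ^ 2) fun i => by fun_prop) hb
    fun i => h.sqExp i _ hu
  refine (measureReal_mono fun ω hω => ?_).trans this
  simp only [Set.mem_ofPred_eq, not_le, Pi.smul_apply, smul_eq_mul, mul_assoc, ← Finset.mul_sum,
    mul_pow] at hω ⊢
  rw [← hr2] at hω
  rw [div_pow, one_pow, one_div, inv_mul_eq_div, le_div_iff₀ (by positivity)]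
  exact le_of_eq_of_le (by ring) hω.le

/-- The squared Frobenius norm of a weighted design. -/
lemma measureReal_frobenius_le (h : IsoDesign μ b Z) (hb : 0 < b) {w : κ → ℝ}
    (hw : ∀ j, 0 ≤ w j) :
    μ.real {ω | ¬ ∑ i, ∑ j, w j * Z i j ω ^ 2 ≤ 2 * n / b * ∑ j, w j} ≤ Real.exp (-n) := by
  classical
  have hmeas := h.measurable
  have hW : 0 ≤ ∑ j, w j := Finset.sum_nonneg fun j _ => hw j
  rcases hW.eq_or_lt with h0 | h0
  · have hs : ∀ j, w j = 0 := by
      simpa using (Finset.sum_eq_zero_iff_of_nonneg fun j _ => hw j).1 h0.symm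
    simp [hs, Real.exp_nonneg]
  set W := ∑ j, w j
  have hsq : ∀ i j, SqExpLE μ b (Z i j) := fun i j => by
    simpa [Pi.single_apply] using h.sqExp i (Pi.single j 1) (by simp)
  -- Normalized weights make each row contribute a convex combination of squares, whose exponential
  -- moment is bounded without independence inside the row.
  have := measureReal_sum_ge_le (μ := μ)
    (U := fun i ω => ∑ j, w j / W * Z i j ω ^ 2) (fun i => by fun_prop)
    (h.indep.comp (fun _ x => ∑ j, w j / W * x j ^ 2) fun i => by fun_prop) hb
    fun i => integral_exp_convex_sq_le (hmeas i) (hsq i) (fun j => div_nonneg (hw j) hW)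
      (by rw [← Finset.sum_div, div_self h0.ne'])
  refine (measureReal_mono fun ω hω => ?_).trans this
  simp only [Set.mem_ofPred_eq, not_le] at hω ⊢
  simp_rw [div_mul_eq_mul_div, ← Finset.sum_div]
  rw [le_div_iff₀ h0]
  exact hω.le

end IsoDesign

end

/-! ### Quadratic forms of the noise -/

section

variable {Ω : Type*} [MeasurableSpace Ω] {μ : Measure Ω} [IsProbabilityMeasure μ]

/-- A quadratic form in independent centered sub-Gaussian variables. -/
lemma measureReal_noise_le {n : ℕ} {κ : Type*} [Fintype κ] {ε : Fin n → Ω → ℝ}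
    (hε : ∀ i, Measurable (ε i)) (hi : iIndepFun ε μ) (h0 : ∀ i, ∫ ω, ε i ω ∂μ = 0) {b : ℝ}
    (hb : 0 < b) (h : ∀ i, SqExpLE μ b (ε i)) (B : Fin n → κ → ℝ) (t : ℝ) :
    μ.real {ω | ¬ ∑ j, (∑ i, B i j * ε i ω) ^ 2 ≤ 8 / b * t * ∑ i, ∑ j, B i j ^ 2} ≤
      2 * Real.exp (-t) := by
  have hsg := fun i => (h i).hasSubgaussianMGF hb (hε i) (h0 i)
  rw [Finset.sum_comm]
  set T : κ → ℝ := fun j => ∑ i, B i j ^ 2 with hT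
  have hT0 : ∀ j, 0 ≤ T j := fun j => Finset.sum_nonneg fun i _ => sq_nonneg _
  have hW : 0 ≤ ∑ j, T j := Finset.sum_nonneg fun j _ => hT0 j
  have hB0 : ∀ j, T j = 0 → ∀ i, B i j = 0 := fun j hj i => by
    have := (Finset.sum_eq_zero_iff_of_nonneg fun i _ => sq_nonneg _).1 hj i (Finset.mem_univ i)
    simpa using this
  rcases hW.eq_or_lt with hW0 | hW0
  · have hs : ∀ j, T j = 0 := by
      simpa using (Finset.sum_eq_zero_iff_of_nonneg fun j _ => hT0 j).1 hW0.symm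
    have hB : ∀ i j, B i j = 0 := fun i j => hB0 j (hs j) i
    simp [hs, hB, Real.exp_nonneg]
  have hmY : ∀ j, Measurable fun ω => ∑ i, B i j / √(T j) * ε i ω := fun j => by fun_prop
  -- Normalized columns give variables with a common exponential moment. A zero column is harmless:
  -- division by √0 returns 0, so its variable vanishes.
  have hY : ∀ j, SqExpLE μ (b / 8) fun ω => ∑ i, B i j / √(T j) * ε i ω := by
    intro j
    rcases (hT0 j).eq_or_lt with hj | hj
    · simp [SqExpLE, ← hj]
    · have := sqExpLE_of_hasSubgaussianMGF (hmY j) (c := 1 * (2 / b).toNNReal) (by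
        rw [one_mul, Real.toNNReal_pos]; positivity) (hasSubgaussianMGF_sum_mul hi hsg
        (fun i => B i j / √(T j)) (by
          simp_rw [div_pow, Real.sq_sqrt (hT0 j), ← Finset.sum_div]
          exact div_self hj.ne'))
      rw [one_mul, Real.coe_toNNReal _ (by positivity)] at this
      convert this using 1
      field_simp
      norm_num
  have hc := integral_exp_convex_sq_le hmY hY (a := fun j => T j / ∑ j, T j)
    (fun j => div_nonneg (hT0 j) hW) (by rw [← Finset.sum_div, div_self hW0.ne'])
  have hm := measure_ge_le_exp_mul_mgf (μ := μ)
    (X := fun ω => ∑ j, T j / (∑ j, T j) * (∑ i, B i j / √(T j) * ε i ω) ^ 2)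
    (t := b / 8) (8 / b * t) (by positivity) hc.1
  have e : -(b / 8) * (8 / b * t) = -t := by field_simp
  rw [e] at hm
  have hfin : ∀ ω, ∑ j, T j / (∑ j, T j) * (∑ i, B i j / √(T j) * ε i ω) ^ 2 =
      (∑ j, (∑ i, B i j * ε i ω) ^ 2) / ∑ j, T j := by
    intro ω
    rw [Finset.sum_div]
    refine Finset.sum_congr rfl fun j _ => ?_
    rcases (hT0 j).eq_or_lt with hj | hj
    · simp [hB0 j hj.symm, ← hj]
    · simp_rw [div_mul_eq_mul_div]
      rw [← Finset.sum_div, div_pow, Real.sq_sqrt (hT0 j)]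
      field_simp
  refine (measureReal_mono fun ω hω => ?_).trans (hm.trans ?_)
  · simp only [Set.mem_ofPred_eq, not_le, hfin] at hω ⊢
    rw [le_div_iff₀ hW0]
    exact hω.le
  · rw [mul_comm 2]
    gcongr
    exact hc.2

/-- The same bound for random coefficients that are independent of the noise. -/
lemma measureReal_noise_random_le {n : ℕ} {κ : Type*} [Fintype κ] {E : Type*} [MeasurableSpace E]
    {X : Ω → E} {ε : Ω → Fin n → ℝ} (hX : Measurable X) (hε : Measurable ε)
    (hXε : IndepFun X ε μ) (hi : iIndepFun (fun i ω => ε ω i) μ) (h0 : ∀ i, ∫ ω, ε ω i ∂μ = 0)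
    {b : ℝ} (hb : 0 < b) (h : ∀ i, SqExpLE μ b fun ω => ε ω i) {B : E → Fin n → κ → ℝ}
    (hB : ∀ i j, Measurable fun x => B x i j) (t : ℝ) :
    μ.real {ω | ¬ ∑ j, (∑ i, B (X ω) i j * ε ω i) ^ 2 ≤
      8 / b * t * ∑ i, ∑ j, B (X ω) i j ^ 2} ≤ 2 * Real.exp (-t) := by
  set S : Set (E × (Fin n → ℝ)) := {q | ¬ ∑ j, (∑ i, B q.1 i j * q.2 i) ^ 2 ≤
      8 / b * t * ∑ i, ∑ j, B q.1 i j ^ 2} with hS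
  have hB' : ∀ i j, Measurable fun q : E × (Fin n → ℝ) => B q.1 i j := fun i j =>
    (hB i j).comp measurable_fst
  have hSm : MeasurableSet S := by
    have h1 : Measurable fun q : E × (Fin n → ℝ) => ∑ j, (∑ i, B q.1 i j * q.2 i) ^ 2 := by
      fun_prop
    have h2 : Measurable fun q : E × (Fin n → ℝ) => 8 / b * t * ∑ i, ∑ j, B q.1 i j ^ 2 := by
      fun_prop
    exact (measurableSet_le h1 h2).compl
  -- The joint law is a product, so X can be frozen and the bound for deterministic coefficients
  -- integrated over the law of X.
  have hlaw := (indepFun_iff_map_prod_eq_prod_map_map hX.aemeasurable hε.aemeasurable).1 hXε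
  have hpre : μ {ω | ¬ ∑ j, (∑ i, B (X ω) i j * ε ω i) ^ 2 ≤
      8 / b * t * ∑ i, ∑ j, B (X ω) i j ^ 2} = μ.map (fun ω => (X ω, ε ω)) S := by
    rw [Measure.map_apply (by fun_prop) hSm]
    rfl
  have hpX : IsProbabilityMeasure (μ.map X) := Measure.isProbabilityMeasure_map hX.aemeasurable
  have hpε : IsProbabilityMeasure (μ.map ε) := Measure.isProbabilityMeasure_map hε.aemeasurable
  rw [measureReal_def, hpre, hlaw, Measure.prod_apply hSm]
  refine ENNReal.toReal_le_of_le_ofReal (by positivity) ?_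
  calc _ ≤ ∫⁻ _, ENNReal.ofReal (2 * Real.exp (-t)) ∂(μ.map X) := by
        refine lintegral_mono fun x => ?_
        rw [Measure.map_apply hε (measurable_prodMk_left hSm)]
        have := measureReal_noise_le (fun i => by fun_prop) hi h0 hb h (B x) t
        rw [measureReal_def] at this
        exact (ENNReal.le_ofReal_iff_toReal_le (measure_ne_top _ _) (by positivity)).2 this
    _ = _ := by simp

/-- Cramer's rule: adjugate times inverse determinant, valid also at singular matrices, where both
conventions return 0. It is needed to treat A⁻¹Z as a random coefficient matrix. -/
lemma measurable_matrix_inv_apply {E : Type*} [MeasurableSpace E] {n : Type*} [Fintype n]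
    [DecidableEq n] {A : E → Matrix n n ℝ} (hA : ∀ i j, Measurable fun x => A x i j) (i j : n) :
    Measurable fun x => (A x)⁻¹ i j := by
  have hdet : ∀ {M : E → Matrix n n ℝ}, (∀ i j, Measurable fun x => M x i j) →
      Measurable fun x => (M x).det := by
    intro M hM
    simp only [det_apply]
    exact Finset.measurable_sum _ fun σ _ =>
      (Finset.measurable_prod _ fun i _ => hM _ _).const_smul _
  simp only [inv_def, Matrix.smul_apply, smul_eq_mul, Ring.inverse_eq_inv']
  refine (hdet hA).inv.mul ?_
  simp only [adjugate_apply]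
  refine hdet fun i' j' => ?_
  simp only [updateRow_apply]
  split_ifs
  · exact measurable_const
  · exact hA i' j'

end

/-! ### Deterministic bounds for bias and variance -/

section

section Deterministic

lemma colGram_transpose {ι η : Type*} [Fintype η] (w : η → ℝ)
    (Z : Matrix ι η ℝ) : (colGram w Z)ᵀ = colGram w Z := by
  ext i i'
  simp only [transpose_apply, colGram, of_apply]
  exact Finset.sum_congr rfl fun j _ => by ring

variable {ι η τ : Type*} [Fintype ι] [Fintype η] [Fintype τ]

lemma dotProduct_self_nonneg' (x : ι → ℝ) : 0 ≤ x ⬝ᵥ x :=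
  Finset.sum_nonneg fun _ _ => mul_self_nonneg _

lemma two_mul_dotProduct_le {s : ℝ} (hs : 0 < s) (x y : ι → ℝ) :
    2 * (x ⬝ᵥ y) ≤ s * (x ⬝ᵥ x) + (y ⬝ᵥ y) / s := by
  have h := dotProduct_self_nonneg' (s • x - y)
  simp only [sub_dotProduct, dotProduct_sub, smul_dotProduct, dotProduct_smul, smul_eq_mul,
    dotProduct_comm y x] at h
  have e : s * (x ⬝ᵥ x) + (y ⬝ᵥ y) / s - 2 * (x ⬝ᵥ y) =
      (s * (s * (x ⬝ᵥ x) - x ⬝ᵥ y) - (s * (x ⬝ᵥ y) - y ⬝ᵥ y)) / s := by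
    field_simp; ring
  have := div_nonneg h hs.le
  linarith

/-- Expand |Ax - mx|² ≥ 0; neither symmetry nor diagonalization is needed. -/
lemma sq_mul_dotProduct_le {A : Matrix ι ι ℝ} {m : ℝ} (hm : 0 ≤ m)
    (hA : ∀ v, m * (v ⬝ᵥ v) ≤ v ⬝ᵥ A *ᵥ v) (x : ι → ℝ) :
    m ^ 2 * (x ⬝ᵥ x) ≤ (A *ᵥ x) ⬝ᵥ (A *ᵥ x) := by
  have h := dotProduct_self_nonneg' (A *ᵥ x - m • x)
  simp only [sub_dotProduct, dotProduct_sub, smul_dotProduct, dotProduct_smul, smul_eq_mul,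
    dotProduct_comm (A *ᵥ x) x] at h
  nlinarith [mul_le_mul_of_nonneg_left (hA x) hm]

/-- This is A² ≤ MA, obtained by evaluating the nonnegative form at Mx - Ax. Applied at A⁻¹y it
bounds ⟨y, A⁻¹y⟩ below by |y|²/M. -/
lemma dotProduct_mulVec_self_le {A : Matrix ι ι ℝ} (hsym : Aᵀ = A) {M : ℝ} (hM : 0 < M)
    (h0 : ∀ v, 0 ≤ v ⬝ᵥ A *ᵥ v) (hA : ∀ v, v ⬝ᵥ A *ᵥ v ≤ M * (v ⬝ᵥ v)) (x : ι → ℝ) :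
    (A *ᵥ x) ⬝ᵥ (A *ᵥ x) ≤ M * (x ⬝ᵥ A *ᵥ x) := by
  have h := h0 (M • x - A *ᵥ x)
  have h2 := hA (A *ᵥ x)
  have e : x ⬝ᵥ A *ᵥ (A *ᵥ x) = (A *ᵥ x) ⬝ᵥ (A *ᵥ x) := by
    rw [dotProduct_mulVec, ← mulVec_transpose, hsym]
  simp only [mulVec_sub, mulVec_smul, sub_dotProduct, dotProduct_sub, smul_dotProduct,
    dotProduct_smul, smul_eq_mul, e] at h
  have : 0 ≤ M * (M * (x ⬝ᵥ A *ᵥ x) - (A *ᵥ x) ⬝ᵥ (A *ᵥ x)) := by nlinarith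
  nlinarith [nonneg_of_mul_nonneg_right this hM]

lemma isUnit_of_coercive [DecidableEq ι] {A : Matrix ι ι ℝ} {m : ℝ} (hm : 0 < m)
    (hA : ∀ v, m * (v ⬝ᵥ v) ≤ v ⬝ᵥ A *ᵥ v) : IsUnit A := by
  rw [← mulVec_injective_iff_isUnit]
  intro x y hxy
  have h := hA (x - y)
  simp only [mulVec_sub] at h
  have hxy' : A *ᵥ x = A *ᵥ y := hxy
  rw [hxy', sub_self, dotProduct_zero] at h
  have h0 : (x - y) ⬝ᵥ (x - y) = 0 :=
    le_antisymm (by nlinarith) (dotProduct_self_nonneg' _)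
  exact sub_eq_zero.1 (dotProduct_self_eq_zero.1 h0)

lemma mulVec_inv_mulVec [DecidableEq ι] {A : Matrix ι ι ℝ} (h : IsUnit A) (x : ι → ℝ) :
    A *ᵥ (A⁻¹ *ᵥ x) = x := by
  rw [mulVec_mulVec, mul_nonsing_inv _ ((isUnit_iff_isUnit_det _).1 h), one_mulVec]

lemma colGram_mulVec (w : η → ℝ) (Z : Matrix ι η ℝ) (v : ι → ℝ) :
    colGram w Z *ᵥ v = Z *ᵥ fun j => w j * (v ᵥ* Z) j := by
  ext i
  simp only [mulVec, vecMul, dotProduct, colGram, of_apply, Finset.sum_mul, Finset.mul_sum]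
  rw [Finset.sum_comm]
  exact Finset.sum_congr rfl fun j _ => Finset.sum_congr rfl fun i' _ => by ring

lemma mulVec_dotProduct_eq (Z : Matrix ι η ℝ) (w : η → ℝ) (v : ι → ℝ) :
    (Z *ᵥ w) ⬝ᵥ v = w ⬝ᵥ (v ᵥ* Z) := by
  rw [dotProduct_comm, dotProduct_mulVec, dotProduct_comm]

/-- If `A v = Z w + z` and `⟨Z w, v⟩ ≤ ⟨w, q⟩`, where `m ≤ A ≤ M` and `n / 2 ≤ Zᵀ Z ≤ 3 n / 2`,
then `w` is controlled by `q` and `z`. -/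
lemma head_bound [DecidableEq ι] {A : Matrix ι ι ℝ} (hsym : Aᵀ = A) {m M : ℝ} (hm : 0 < m)
    (hM : 0 < M)
    (hA : ∀ v, m * (v ⬝ᵥ v) ≤ v ⬝ᵥ A *ᵥ v) (hA' : ∀ v, v ⬝ᵥ A *ᵥ v ≤ M * (v ⬝ᵥ v))
    {n : ℝ} (hn : 0 < n) {Z : Matrix ι η ℝ}
    (hZ : ∀ w, |(Z *ᵥ w) ⬝ᵥ (Z *ᵥ w) - n * (w ⬝ᵥ w)| ≤ n / 2 * (w ⬝ᵥ w))
    {v z : ι → ℝ} {w q : η → ℝ} (hv : A *ᵥ v = Z *ᵥ w + z) (hw : (Z *ᵥ w) ⬝ᵥ v ≤ w ⬝ᵥ q) :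
    w ⬝ᵥ w ≤ 8 * (M / n) ^ 2 * (q ⬝ᵥ q) + 16 * (M / m) ^ 2 * ((z ⬝ᵥ z) / n) := by
  have hu := isUnit_of_coercive hm hA
  set v₂ := A⁻¹ *ᵥ z with hv₂
  have h2 : A *ᵥ v₂ = z := mulVec_inv_mulVec hu z
  set v₁ := v - v₂ with hv₁
  set y := Z *ᵥ w with hy
  have h1 : A *ᵥ v₁ = y := by rw [hv₁, mulVec_sub, h2, hv]; simp
  have hyv₁ : y ⬝ᵥ y ≤ M * (y ⬝ᵥ v₁) := by
    have := dotProduct_mulVec_self_le hsym hM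
      (fun v => (mul_nonneg hm.le (dotProduct_self_nonneg' v)).trans (hA v)) hA' v₁
    rwa [h1, dotProduct_comm v₁] at this
  have hv₂z : m ^ 2 * (v₂ ⬝ᵥ v₂) ≤ z ⬝ᵥ z := by
    have := sq_mul_dotProduct_le hm.le hA v₂
    rwa [h2] at this
  have hsplit : y ⬝ᵥ v = y ⬝ᵥ v₁ + y ⬝ᵥ v₂ := by rw [hv₁, dotProduct_sub]; ring
  have hyn := abs_le.1 (hZ w)
  rw [← hy] at hyn
  have hw0 := dotProduct_self_nonneg' w
  -- α is the coercivity constant of w ↦ ⟨Zw, A⁻¹Zw⟩. The Young parameters α/2 and α/(4n) make each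
  -- cross term cost at most (α/2)|w|², half of the available 2α|w|² in total.
  set α := n / (2 * M) with hα
  have hα0 : 0 < α := by positivity
  have k1 : α * (w ⬝ᵥ w) ≤ y ⬝ᵥ v₁ := by
    rw [hα, div_mul_eq_mul_div, div_le_iff₀ (by positivity)]
    nlinarith
  have k2 := two_mul_dotProduct_le (show 0 < α / 2 by positivity) w q
  have k3 := two_mul_dotProduct_le (show 0 < α / (4 * n) by positivity) y (-v₂)
  simp only [dotProduct_neg, neg_dotProduct, neg_neg] at k3
  have k4 : α / (4 * n) * (y ⬝ᵥ y) ≤ α / 2 * (w ⬝ᵥ w) := by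
    calc α / (4 * n) * (y ⬝ᵥ y) ≤ α / (4 * n) * (2 * n * (w ⬝ᵥ w)) := by
          gcongr; nlinarith
      _ = _ := by field_simp; norm_num
  have k5 : v₂ ⬝ᵥ v₂ ≤ (z ⬝ᵥ z) / m ^ 2 := by
    rw [le_div_iff₀ (by positivity)]; linarith
  have k6 : (v₂ ⬝ᵥ v₂) / (α / (4 * n)) ≤ (z ⬝ᵥ z) / m ^ 2 / (α / (4 * n)) := by gcongr
  have k7 : α * (w ⬝ᵥ w) ≤ (q ⬝ᵥ q) / (α / 2) + (z ⬝ᵥ z) / m ^ 2 / (α / (4 * n)) := by linarith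
  calc w ⬝ᵥ w = α * (w ⬝ᵥ w) / α := by field_simp
    _ ≤ ((q ⬝ᵥ q) / (α / 2) + (z ⬝ᵥ z) / m ^ 2 / (α / (4 * n))) / α := by gcongr
    _ = _ := by rw [hα]; field_simp; ring

/-- Bound for the bias in terms of the split of the spectrum. -/
lemma bias_bound [DecidableEq ι] {A : Matrix ι ι ℝ} (hsym : Aᵀ = A) {m M : ℝ} (hm : 0 < m)
    (hM : 0 < M)
    (hA : ∀ v, m * (v ⬝ᵥ v) ≤ v ⬝ᵥ A *ᵥ v) (hA' : ∀ v, v ⬝ᵥ A *ᵥ v ≤ M * (v ⬝ᵥ v))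
    {n : ℝ} (hn : 0 < n) {Z : Matrix ι η ℝ} {Y : Matrix ι τ ℝ}
    (hZ : ∀ w, |(Z *ᵥ w) ⬝ᵥ (Z *ᵥ w) - n * (w ⬝ᵥ w)| ≤ n / 2 * (w ⬝ᵥ w))
    {d : η → ℝ} (hd : ∀ j, 0 < d j) {e : τ → ℝ} (he : ∀ j, 0 < e j) {α : η → ℝ} {β : τ → ℝ}
    {v : ι → ℝ} (hv : (A + colGram d Z) *ᵥ v =
      (Z *ᵥ fun j => √(d j) * α j) + Y *ᵥ fun j => √(e j) * β j)
    {K G R : ℝ} (hK0 : 0 ≤ K) (hR0 : 0 ≤ R)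
    (hK : (Y *ᵥ fun j => √(e j) * β j) ⬝ᵥ (Y *ᵥ fun j => √(e j) * β j) ≤
      K * n * ∑ j, e j * β j ^ 2)
    (hG : ∀ v : ι → ℝ, ∑ j, e j ^ 2 * (v ᵥ* Y) j ^ 2 ≤ G * (v ⬝ᵥ v))
    (hR : G * n ≤ R * m ^ 2) :
    ∑ j, d j * (α j - √(d j) * (v ᵥ* Z) j) ^ 2 + ∑ j, e j * (β j - √(e j) * (v ᵥ* Y) j) ^ 2 ≤
      ((1 + 8 * R) * (8 + 16 * K * (M / m) ^ 2) + 2 + 4 * R * K) *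
        (∑ j, e j * β j ^ 2 + (M / n) ^ 2 * ∑ j, α j ^ 2 / d j) := by
  set z := Y *ᵥ fun j => √(e j) * β j with hz
  set w : η → ℝ := fun j => √(d j) * (α j - √(d j) * (v ᵥ* Z) j) with hw
  set q : η → ℝ := fun j => α j / √(d j) with hq
  have hsd : ∀ j, √(d j) ^ 2 = d j := fun j => Real.sq_sqrt (hd j).le
  have hse : ∀ j, √(e j) ^ 2 = e j := fun j => Real.sq_sqrt (he j).le
  have hsd0 : ∀ j, 0 < √(d j) := fun j => Real.sqrt_pos.2 (hd j)
  have hww : w ⬝ᵥ w = ∑ j, d j * (α j - √(d j) * (v ᵥ* Z) j) ^ 2 :=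
    Finset.sum_congr rfl fun j _ => by
      calc _ = √(d j) ^ 2 * (α j - √(d j) * (v ᵥ* Z) j) ^ 2 := by simp only [hw]; ring
        _ = _ := by rw [hsd]
  have hqq : q ⬝ᵥ q = ∑ j, α j ^ 2 / d j :=
    Finset.sum_congr rfl fun j _ => by
      simp only [hq]; rw [div_mul_div_comm, ← sq, ← sq, hsd]
  have hAv : A *ᵥ v = Z *ᵥ w + z := by
    rw [add_mulVec, colGram_mulVec] at hv
    rw [eq_sub_of_add_eq hv, add_sub_right_comm, ← mulVec_sub]
    congr 2
    ext j
    simp only [Pi.sub_apply, hw]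
    rw [mul_sub, ← mul_assoc, ← sq, hsd]
  have hwv : (Z *ᵥ w) ⬝ᵥ v ≤ w ⬝ᵥ q := by
    rw [mulVec_dotProduct_eq]
    refine Finset.sum_le_sum fun j _ => ?_
    -- The slack is exactly the squared head residual; dropping it removes the dependence on d.
    have : w j * q j - w j * (v ᵥ* Z) j = (α j - √(d j) * (v ᵥ* Z) j) ^ 2 := by
      simp only [hw, hq]
      have := (hsd0 j).ne'
      field_simp
    nlinarith [sq_nonneg (α j - √(d j) * (v ᵥ* Z) j)]
  have hT0 : 0 ≤ ∑ j, e j * β j ^ 2 :=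
    Finset.sum_nonneg fun j _ => mul_nonneg (he j).le (sq_nonneg _)
  have hH0 : 0 ≤ ∑ j, α j ^ 2 / d j :=
    Finset.sum_nonneg fun j _ => div_nonneg (sq_nonneg _) (hd j).le
  have hhead := head_bound hsym hm hM hA hA' hn hZ hAv hwv
  rw [hqq] at hhead
  have hzn : (z ⬝ᵥ z) / n ≤ K * ∑ j, e j * β j ^ 2 := by
    rw [div_le_iff₀ hn]; linarith
  have hvv : m ^ 2 * (v ⬝ᵥ v) ≤ 4 * n * (w ⬝ᵥ w) + 2 * (K * n * ∑ j, e j * β j ^ 2) := by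
    have h1 := sq_mul_dotProduct_le hm.le hA v
    rw [hAv] at h1
    have h2 := two_mul_dotProduct_le one_pos (Z *ᵥ w) z
    have h3 := (abs_le.1 (hZ w)).2
    simp only [add_dotProduct, dotProduct_add, dotProduct_comm z (Z *ᵥ w)] at h1
    nlinarith [dotProduct_self_nonneg' w, mul_nonneg hn.le (dotProduct_self_nonneg' w)]
  have htail : ∑ j, e j * (β j - √(e j) * (v ᵥ* Y) j) ^ 2 ≤
      2 * ∑ j, e j * β j ^ 2 + 2 * (G * (v ⬝ᵥ v)) := by
    calc _ ≤ ∑ j, (2 * (e j * β j ^ 2) + 2 * (e j ^ 2 * (v ᵥ* Y) j ^ 2)) := by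
          refine Finset.sum_le_sum fun j _ => ?_
          have h1 : (√(e j) * (v ᵥ* Y) j) ^ 2 = e j * (v ᵥ* Y) j ^ 2 := by rw [mul_pow, hse]
          have h2 : 0 ≤ e j * (β j + √(e j) * (v ᵥ* Y) j) ^ 2 :=
            mul_nonneg (he j).le (sq_nonneg _)
          have h3 : e j * (√(e j) * (v ᵥ* Y) j) ^ 2 = e j ^ 2 * (v ᵥ* Y) j ^ 2 := by
            rw [h1]; ring
          linarith
      _ = 2 * ∑ j, e j * β j ^ 2 + 2 * ∑ j, e j ^ 2 * (v ᵥ* Y) j ^ 2 := by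
          rw [Finset.sum_add_distrib, Finset.mul_sum, Finset.mul_sum]
      _ ≤ _ := by gcongr; exact hG v
  have hGv : G * (v ⬝ᵥ v) ≤ R * (4 * (w ⬝ᵥ w) + 2 * (K * ∑ j, e j * β j ^ 2)) := by
    have h1 : n * (G * (v ⬝ᵥ v)) ≤ n * (R * (4 * (w ⬝ᵥ w) + 2 * (K * ∑ j, e j * β j ^ 2))) := by
      calc n * (G * (v ⬝ᵥ v)) = G * n * (v ⬝ᵥ v) := by ring
        _ ≤ R * m ^ 2 * (v ⬝ᵥ v) := by gcongr; exact dotProduct_self_nonneg' v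
        _ = R * (m ^ 2 * (v ⬝ᵥ v)) := by ring
        _ ≤ R * (4 * n * (w ⬝ᵥ w) + 2 * (K * n * ∑ j, e j * β j ^ 2)) := by gcongr
        _ = _ := by ring
    exact le_of_mul_le_mul_left h1 hn
  rw [← hww]
  set T := ∑ j, e j * β j ^ 2
  set H := ∑ j, α j ^ 2 / d j
  set P := (M / n) ^ 2 * H with hP
  have hP0 : 0 ≤ P := by positivity
  set L := (M / m) ^ 2 with hL
  have hL0 : 0 ≤ L := by positivity
  have hw2 : w ⬝ᵥ w ≤ (8 + 16 * K * L) * (T + P) := by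
    have : 16 * L * (z ⬝ᵥ z / n) ≤ 16 * L * (K * T) := by gcongr
    have e1 : 0 ≤ K * L * P := by positivity
    nlinarith
  calc _ ≤ (1 + 8 * R) * (w ⬝ᵥ w) + (2 + 4 * R * K) * T := by nlinarith
    _ ≤ (1 + 8 * R) * ((8 + 16 * K * L) * (T + P)) + (2 + 4 * R * K) * (T + P) := by
        gcongr
        linarith
    _ = _ := by ring

/-- Bound for the variance in terms of the split of the spectrum. -/
lemma variance_head_bound [DecidableEq ι] {A : Matrix ι ι ℝ} (hsym : Aᵀ = A) {m M : ℝ}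
    (hm : 0 < m) (hM : 0 < M)
    (hA : ∀ v, m * (v ⬝ᵥ v) ≤ v ⬝ᵥ A *ᵥ v) (hA' : ∀ v, v ⬝ᵥ A *ᵥ v ≤ M * (v ⬝ᵥ v))
    {n : ℝ} (hn : 0 < n) {Z : Matrix ι η ℝ}
    (hZ : ∀ w, |(Z *ᵥ w) ⬝ᵥ (Z *ᵥ w) - n * (w ⬝ᵥ w)| ≤ n / 2 * (w ⬝ᵥ w))
    {d : η → ℝ} (hd : ∀ j, 0 < d j) {v x : ι → ℝ} (hv : (A + colGram d Z) *ᵥ v = x) :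
    ∑ j, d j ^ 2 * (v ᵥ* Z) j ^ 2 ≤
      8 * (M / n) ^ 2 * (((A⁻¹ *ᵥ x) ᵥ* Z) ⬝ᵥ ((A⁻¹ *ᵥ x) ᵥ* Z)) := by
  have hu := isUnit_of_coercive hm hA
  set w : η → ℝ := fun j => d j * (v ᵥ* Z) j with hw
  -- Subtracting the head-free solution A⁻¹x brings the equation into the form of `head_bound` with
  -- z = 0.
  have h1 : A *ᵥ (A⁻¹ *ᵥ x - v) = Z *ᵥ w + 0 := by
    rw [mulVec_sub, mulVec_inv_mulVec hu, ← hv, add_mulVec, colGram_mulVec]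
    simp [hw]
  have h2 : (Z *ᵥ w) ⬝ᵥ (A⁻¹ *ᵥ x - v) ≤ w ⬝ᵥ ((A⁻¹ *ᵥ x) ᵥ* Z) := by
    rw [mulVec_dotProduct_eq, sub_vecMul, dotProduct_sub]
    have : 0 ≤ w ⬝ᵥ (v ᵥ* Z) := Finset.sum_nonneg fun j _ => by
      simp only [hw]; nlinarith [mul_nonneg (hd j).le (sq_nonneg ((v ᵥ* Z) j))]
    linarith
  have := head_bound hsym hm hM hA hA' hn hZ h1 h2
  simp only [dotProduct_zero, zero_div, mul_zero, add_zero] at this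
  refine le_of_eq_of_le ?_ this
  exact Finset.sum_congr rfl fun j _ => by simp only [hw]; ring

/-- Multiplication by the inverse of a coercive matrix shrinks the Frobenius norm. -/
lemma frobenius_inv_mul_le [DecidableEq ι] {A : Matrix ι ι ℝ} {m : ℝ} (hm : 0 < m)
    (hA : ∀ v, m * (v ⬝ᵥ v) ≤ v ⬝ᵥ A *ᵥ v) (B : Matrix ι η ℝ) :
    ∑ i, ∑ j, (A⁻¹ * B) i j ^ 2 ≤ (∑ i, ∑ j, B i j ^ 2) / m ^ 2 := by
  rw [le_div_iff₀ (by positivity), Finset.sum_comm, Finset.sum_comm (f := fun i j => B i j ^ 2),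
    Finset.sum_mul]
  refine Finset.sum_le_sum fun j _ => ?_
  have h := sq_mul_dotProduct_le hm.le hA (A⁻¹ *ᵥ fun i => B i j)
  rw [mulVec_inv_mulVec (isUnit_of_coercive hm hA)] at h
  simp only [dotProduct, ← sq] at h
  rw [mul_comm]
  exact h

end Deterministic

end

/-! ### Whitening the model and splitting the spectrum at k -/

section

/-- Dividing column j by √λ_j makes the covariance the identity. The strict bound σx < K is what
allows passing from the infimum in the norm to an actual exponential moment. -/
lemma isoDesign_of_model {Ω : Type*} [MeasurableSpace Ω] {μ : Measure Ω} [IsProbabilityMeasure μ]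
    {n p : ℕ} {σx σε : ℝ} {lam : Fin p → ℝ} {X : Ω → Fin n → Fin p → ℝ} {ε : Ω → Fin n → ℝ}
    (h : Model μ σx σε lam X ε) {K : ℝ} (hK : 0 < K) (hσ : σx < K) :
    IsoDesign μ (1 / K ^ 2) fun i j ω => X ω i j / √(lam j) := by
  have hX := h.measurable_design
  have hm : ∀ i j, Measurable fun ω => X ω i j / √(lam j) := fun i j => by fun_prop
  have hsq : ∀ i (s : Fin p → ℝ), s ⬝ᵥ s = 1 →
      SqExpLE μ (1 / K ^ 2) fun ω => ∑ j, s j * (X ω i j / √(lam j)) := by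
    intro i s hs
    refine sqExpLE_of_psi2Norm_lt (by fun_prop) hK ?_
    refine lt_of_le_of_lt ?_ ((ENNReal.ofReal_lt_ofReal_iff hK).2 hσ)
    have hn : ‖(WithLp.toLp 2 s : EuclideanSpace ℝ (Fin p))‖ = 1 := by
      have := dotProduct_self_eq_norm_sq (WithLp.toLp 2 s : EuclideanSpace ℝ (Fin p))
      rw [hs] at this
      exact (pow_eq_one_iff_of_nonneg (norm_nonneg _) two_ne_zero).1 this.symm
    have hne : (WithLp.toLp 2 s : EuclideanSpace ℝ (Fin p)) ≠ 0 := by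
      rw [← norm_ne_zero_iff, hn]; exact one_ne_zero
    refine le_trans (le_of_eq ?_) ((le_iSup₂ (f := fun (s : EuclideanSpace ℝ (Fin p)) (_ : s ≠ 0) =>
      psi2Norm μ fun ω => inner ℝ s (WithLp.toLp 2 fun j => X ω i j / √(lam j)) / ‖s‖) _
      hne).trans (h.rows_subgaussian i))
    congr 1
    ext ω
    rw [hn, div_one, PiLp.inner_apply]
    exact Finset.sum_congr rfl fun j _ => by simp [mul_comm]
  have hmem : ∀ i j, MemLp (fun ω => X ω i j / √(lam j)) 2 μ := by
    intro i j
    have := (hsq i (Pi.single j 1) (by simp)).memLp_two (by positivity) (by fun_prop)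
    simpa [Pi.single_apply] using this
  have hc : ∀ i j, ∫ ω, X ω i j / √(lam j) ∂μ = 0 := fun i j => by
    rw [integral_div, h.rows_centered, zero_div]
  refine ⟨hm, h.rows_indep.comp (fun _ x j => x j / √(lam j)) fun i => by fun_prop, hc, ?_, hsq⟩
  intro i s
  have hz : ∫ ω, ∑ j, s j * (X ω i j / √(lam j)) ∂μ = 0 := by
    rw [integral_finsetSum _ fun j _ => ((hmem i j).integrable (by norm_num)).const_mul _]
    simp [integral_const_mul, hc]
  rw [← variance_of_integral_eq_zero (Measurable.aemeasurable (by fun_prop)) hz,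
    variance_fun_sum fun j => (hmem i j).const_mul (s j)]
  refine Finset.sum_congr rfl fun j _ => ?_
  rw [Finset.sum_eq_single j]
  · rw [covariance_const_mul_left, covariance_const_mul_right, covariance_fun_div_left,
      covariance_fun_div_right, h.rows_cov, diagonal_apply_eq, div_div,
      Real.mul_self_sqrt (h.eig_pos j).le, div_self (h.eig_pos j).ne', mul_one]
  · intro j' _ hne
    rw [covariance_const_mul_left, covariance_const_mul_right, covariance_fun_div_left,
      covariance_fun_div_right, h.rows_cov, diagonal_apply_ne _ hne.symm]
    simp
  · simp

lemma matNorm_diagonal_sq {ι : Type*} [Fintype ι] [DecidableEq ι] {d : ι → ℝ} (hd : ∀ j, 0 ≤ d j)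
    (x : ι → ℝ) : matNorm (diagonal d) x ^ 2 = ∑ j, d j * x j ^ 2 := by
  have e : x ⬝ᵥ (diagonal d *ᵥ x) = ∑ j, d j * x j ^ 2 :=
    Finset.sum_congr rfl fun j _ => by rw [mulVec_diagonal]; ring
  rw [matNorm, e, Real.sq_sqrt (Finset.sum_nonneg fun j _ => mul_nonneg (hd j) (sq_nonneg _))]

lemma sum_head_add_sum_tail {p : ℕ} (k : ℕ) (f : Fin p → ℝ) :
    ∑ j, f j = ∑ j : {j : Fin p // (j : ℕ) < k}, f j + ∑ j : {j : Fin p // k ≤ (j : ℕ)}, f j := by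
  rw [← Fintype.sum_subtype_add_sum_subtype fun j : Fin p => (j : ℕ) < k]
  congr 1
  exact Fintype.sum_equiv (Equiv.subtypeEquivRight fun j => not_lt) _ _ fun j => rfl

lemma card_head_le (p k : ℕ) : Fintype.card {j : Fin p // (j : ℕ) < k} ≤ k := by
  calc Fintype.card {j : Fin p // (j : ℕ) < k} ≤ Fintype.card (Fin k) :=
        Fintype.card_le_of_injective (fun j => ⟨j.1, j.2⟩) fun j j' hj => by
          simpa [Subtype.ext_iff, Fin.ext_iff] using hj
    _ = k := Fintype.card_fin k

section

variable {n p : ℕ} {lam : Fin p → ℝ}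

lemma headTerm_eq (k : ℕ) (hlam : ∀ j, 0 < lam j) (θ : Fin p → ℝ) :
    headTerm k lam θ = ∑ j, head k θ j ^ 2 / head k lam j := by
  have hinv : (diagonal (head k lam))⁻¹ = diagonal fun j => (head k lam j)⁻¹ := by
    refine inv_eq_right_inv ?_
    rw [diagonal_mul_diagonal, ← diagonal_one]
    congr 1
    ext j
    exact mul_inv_cancel₀ (hlam j).ne'
  rw [headTerm, hinv, matNorm_diagonal_sq (d := fun j => (head k lam j)⁻¹)
    fun j => (inv_pos.2 (hlam j)).le]
  exact Finset.sum_congr rfl fun j _ => by rw [inv_mul_eq_div]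

lemma tailTerm_eq (k : ℕ) (hlam : ∀ j, 0 < lam j) (θ : Fin p → ℝ) :
    tailTerm k lam θ = ∑ j, tail k lam j * tail k θ j ^ 2 :=
  matNorm_diagonal_sq (d := tail k lam) (fun j => (hlam j).le) _

/-- The first `k` columns of `X Σ^{-1/2}`. -/
def headDesign (k : ℕ) (lam : Fin p → ℝ) (X : Fin n → Fin p → ℝ) :
    Matrix (Fin n) {j : Fin p // (j : ℕ) < k} ℝ :=
  of fun i j => X i j / √(lam j)

/-- The columns of `X Σ^{-1/2}` but the first `k`. -/
def tailDesign (k : ℕ) (lam : Fin p → ℝ) (X : Fin n → Fin p → ℝ) :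
    Matrix (Fin n) {j : Fin p // k ≤ (j : ℕ)} ℝ :=
  of fun i j => X i j / √(lam j)

/-- The matrix `l I_n + X_{k:∞} X_{k:∞}ᵀ`. -/
def tailGram (k : ℕ) (lam : Fin p → ℝ) (l : ℝ) (X : Fin n → Fin p → ℝ) :
    Matrix (Fin n) (Fin n) ℝ :=
  l • (1 : Matrix (Fin n) (Fin n) ℝ) + colGram (tail k lam) (tailDesign k lam X)

lemma tailGram_transpose (k : ℕ) (l : ℝ) (X : Fin n → Fin p → ℝ) :
    (tailGram k lam l X)ᵀ = tailGram k lam l X := by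
  rw [tailGram, transpose_add, transpose_smul, transpose_one, colGram_transpose]

lemma quadForm_tailGram (k : ℕ) (l : ℝ) (X : Fin n → Fin p → ℝ) (v : Fin n → ℝ) :
    v ⬝ᵥ tailGram k lam l X *ᵥ v =
      l * (v ⬝ᵥ v) + ∑ j, tail k lam j * (∑ i, v i * tailDesign k lam X i j) ^ 2 := by
  rw [tailGram, add_mulVec, dotProduct_add, quadForm_colGram, smul_mulVec, one_mulVec,
    dotProduct_smul, smul_eq_mul]

lemma gram_eq (k : ℕ) (hlam : ∀ j, 0 < lam j) (l : ℝ) (X : Fin n → Fin p → ℝ) :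
    gram l (of X) = tailGram k lam l X + colGram (head k lam) (headDesign k lam X) := by
  have hterm : ∀ i i' j, lam j * (X i j / √(lam j) * (X i' j / √(lam j))) = X i j * X i' j := by
    intro i i' j
    rw [div_mul_div_comm, Real.mul_self_sqrt (hlam j).le]
    exact mul_div_cancel₀ _ (hlam j).ne'
  ext i i'
  simp only [gram, tailGram, colGram, Matrix.add_apply, Matrix.mul_apply, transpose_apply, of_apply,
    tailDesign, headDesign, tail, head]
  rw [sum_head_add_sum_tail k]
  simp only [hterm]
  ring

lemma transpose_mulVec_eq (hlam : ∀ j, 0 < lam j) (X : Fin n → Fin p → ℝ) (v : Fin n → ℝ)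
    (j : Fin p) : ((of X)ᵀ *ᵥ v) j = √(lam j) * ∑ i, v i * (X i j / √(lam j)) := by
  have := (Real.sqrt_pos.2 (hlam j)).ne'
  rw [Finset.mul_sum, mulVec, dotProduct]
  refine Finset.sum_congr rfl fun i _ => ?_
  simp only [transpose_apply, of_apply]
  field_simp

lemma mulVec_eq (k : ℕ) (hlam : ∀ j, 0 < lam j) (X : Fin n → Fin p → ℝ) (θ : Fin p → ℝ) :
    of X *ᵥ θ = (headDesign k lam X *ᵥ fun j => √(head k lam j) * head k θ j) +
      tailDesign k lam X *ᵥ fun j => √(tail k lam j) * tail k θ j := by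
  ext i
  simp only [mulVec, dotProduct, Pi.add_apply]
  rw [sum_head_add_sum_tail k]
  congr 1 <;> refine Finset.sum_congr rfl fun j _ => ?_
  · have := (Real.sqrt_pos.2 (hlam j)).ne'
    simp only [headDesign, head, of_apply]
    field_simp
  · have := (Real.sqrt_pos.2 (hlam j)).ne'
    simp only [tailDesign, tail, of_apply]
    field_simp

/-- The deterministic part of the argument: the bounds for the bias and the variance on the event
where the spectrum of the split design is controlled. -/
lemma good_of_bounds {k : ℕ} (hn : 0 < n) (hlam : ∀ j, 0 < lam j) {l : ℝ}
    {X : Fin n → Fin p → ℝ} {e : Fin n → ℝ} {θ : Fin p → ℝ} {m M K G R σ t : ℝ} (hm : 0 < m)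
    (hM : 0 < M) (hK0 : 0 ≤ K) (hR0 : 0 ≤ R) (hσ : 0 < σ) (ht : 0 < t)
    (hA : ∀ v, m * (v ⬝ᵥ v) ≤ v ⬝ᵥ tailGram k lam l X *ᵥ v)
    (hA' : ∀ v, v ⬝ᵥ tailGram k lam l X *ᵥ v ≤ M * (v ⬝ᵥ v))
    (hZ : ∀ w, |∑ i, (∑ j, w j * headDesign k lam X i j) ^ 2 - n * (w ⬝ᵥ w)| ≤
      n / 2 * (w ⬝ᵥ w))
    (hK : ∑ i, (∑ j, √(tail k lam j) * tail k θ j * tailDesign k lam X i j) ^ 2 ≤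
      K * n * tailTerm k lam θ)
    (hG : ∀ v : Fin n → ℝ, ∑ j, tail k lam j ^ 2 * (∑ i, v i * tailDesign k lam X i j) ^ 2 ≤
      G * (v ⬝ᵥ v))
    (hR : G * n ≤ R * m ^ 2)
    (hF : ∑ i, ∑ j, tail k lam j ^ 2 * tailDesign k lam X i j ^ 2 ≤ K * n * tailSqSum k lam)
    (hN₁ : ∑ j, (∑ i, ((tailGram k lam l X)⁻¹ * headDesign k lam X) i j * e i) ^ 2 ≤
      32 * σ ^ 2 * t * ∑ i, ∑ j, ((tailGram k lam l X)⁻¹ * headDesign k lam X) i j ^ 2)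
    (hN₂ : ∑ j, (∑ i, ((gram l (of X))⁻¹ *
        tailDesign k lam X * diagonal (tail k lam)) i j * e i) ^ 2 ≤
      32 * σ ^ 2 * t * ∑ i, ∑ j, ((gram l (of X))⁻¹ *
        tailDesign k lam X * diagonal (tail k lam)) i j ^ 2) :
    IsUnit (gram l (of X)) ∧
      biasTerm lam l (of X) θ ≤ ((1 + 8 * R) * (8 + 16 * K * (M / m) ^ 2) + 2 + 4 * R * K) *
        (tailTerm k lam θ + (M / n) ^ 2 * headTerm k lam θ) ∧
      varTerm lam l (of X) e / (σ ^ 2 * t) ≤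
        384 * (M / m) ^ 2 * (k / n) + 32 * K * (n / m ^ 2) * tailSqSum k lam := by
  have hn' : (0 : ℝ) < n := Nat.cast_pos.2 hn
  have hsym := tailGram_transpose (lam := lam) k l X
  have hgram := gram_eq k hlam l X
  have hAg : ∀ v, m * (v ⬝ᵥ v) ≤ v ⬝ᵥ gram l (of X) *ᵥ v := by
    intro v
    rw [hgram, add_mulVec, dotProduct_add, quadForm_colGram]
    have : 0 ≤ ∑ j, head k lam j * (∑ i, v i * headDesign k lam X i j) ^ 2 :=
      Finset.sum_nonneg fun j _ => mul_nonneg (hlam j).le (sq_nonneg _)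
    linarith [hA v]
  have hu := isUnit_of_coercive hm hAg
  have hZ' : ∀ w, |(headDesign k lam X *ᵥ w) ⬝ᵥ (headDesign k lam X *ᵥ w) - n * (w ⬝ᵥ w)| ≤
      n / 2 * (w ⬝ᵥ w) := by
    intro w
    convert hZ w using 3
    refine Finset.sum_congr rfl fun i _ => ?_
    simp only [mulVec, dotProduct, sq, mul_comm]
  refine ⟨hu, ?_, ?_⟩
  · set v := (gram l (of X))⁻¹ *ᵥ (of X *ᵥ θ) with hv
    have hgv : gram l (of X) *ᵥ v = of X *ᵥ θ := mulVec_inv_mulVec hu _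
    rw [mulVec_eq k hlam, hgram] at hgv
    have hb : biasTerm lam l (of X) θ = ∑ j, head k lam j *
        (head k θ j - √(head k lam j) * (v ᵥ* headDesign k lam X) j) ^ 2 +
        ∑ j, tail k lam j * (tail k θ j - √(tail k lam j) * (v ᵥ* tailDesign k lam X) j) ^ 2 := by
      rw [biasTerm, matNorm_diagonal_sq fun j => (hlam j).le, sum_head_add_sum_tail k]
      have hr : ((1 : Matrix (Fin p) (Fin p) ℝ) - (of X)ᵀ * (gram l (of X))⁻¹ * of X) *ᵥ θ =
          θ - (of X)ᵀ *ᵥ v := by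
        rw [sub_mulVec, one_mulVec, hv, mulVec_mulVec, mulVec_mulVec, Matrix.mul_assoc]
      rw [hr]
      simp only [Pi.sub_apply, transpose_mulVec_eq hlam]
      rfl
    rw [hb, tailTerm_eq k hlam, headTerm_eq k hlam]
    refine bias_bound hsym hm hM hA hA' hn' hZ' (d := head k lam) (fun j => hlam j)
      (e := tail k lam) (fun j => hlam j) hgv hK0 hR0
      ?_ hG hR
    rw [← tailTerm_eq k hlam]
    refine le_of_eq_of_le ?_ hK
    refine Finset.sum_congr rfl fun i _ => ?_
    simp only [mulVec, dotProduct, sq, mul_comm]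
  · set v := (gram l (of X))⁻¹ *ᵥ e with hv
    have hgv : gram l (of X) *ᵥ v = e := mulVec_inv_mulVec hu _
    have hgsym : ((gram l (of X))⁻¹)ᵀ = (gram l (of X))⁻¹ := by
      rw [transpose_nonsing_inv, hgram, transpose_add, hsym, colGram_transpose]
    have hvar : varTerm lam l (of X) e = ∑ j, head k lam j ^ 2 * (v ᵥ* headDesign k lam X) j ^ 2 +
        ∑ j, tail k lam j ^ 2 * (v ᵥ* tailDesign k lam X) j ^ 2 := by
      rw [varTerm, matNorm_diagonal_sq fun j => (hlam j).le, sum_head_add_sum_tail k,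
        ← mulVec_mulVec, ← hv]
      simp only [transpose_mulVec_eq hlam, mul_pow, Real.sq_sqrt (hlam _).le, ← mul_assoc, ← sq]
      rfl
    have hsqc : ∑ i, ∑ j, headDesign k lam X i j ^ 2 ≤ 3 / 2 * n * k := by
      rw [Finset.sum_comm]
      have h1 : ∀ j, ∑ i, headDesign k lam X i j ^ 2 ≤ 3 / 2 * n := by
        intro j
        -- At coordinate vectors the covariance estimate bounds the column norms, hence the
        -- Frobenius norm of the head design by 3nk/2.
        have := (abs_le.1 (hZ (Pi.single j 1))).2
        simp only [Pi.single_apply, ite_mul, one_mul, zero_mul, Finset.sum_ite_eq',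
          Finset.mem_univ, if_true, dotProduct_single, mul_one] at this
        linarith
      refine (Finset.sum_le_sum fun j _ => h1 j).trans ?_
      rw [Finset.sum_const, nsmul_eq_mul, mul_comm]
      gcongr
      exact card_head_le p k
    have hhead : ∑ j, head k lam j ^ 2 * (v ᵥ* headDesign k lam X) j ^ 2 ≤
        σ ^ 2 * t * (384 * (M / m) ^ 2 * (k / n)) := by
      have h1 := variance_head_bound hsym hm hM hA hA' hn' hZ' (d := head k lam) (fun j => hlam j)
        (v := v) (x := e) (by rw [← hgram]; exact hgv)
      have h2 : (((tailGram k lam l X)⁻¹ *ᵥ e) ᵥ* headDesign k lam X) ⬝ᵥ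
          (((tailGram k lam l X)⁻¹ *ᵥ e) ᵥ* headDesign k lam X) =
          ∑ j, (∑ i, ((tailGram k lam l X)⁻¹ * headDesign k lam X) i j * e i) ^ 2 := by
        have : ((tailGram k lam l X)⁻¹ *ᵥ e) ᵥ* headDesign k lam X =
            e ᵥ* ((tailGram k lam l X)⁻¹ * headDesign k lam X) := by
          rw [← vecMul_vecMul, ← mulVec_transpose (tailGram k lam l X)⁻¹, transpose_nonsing_inv,
            hsym]
        rw [this]
        refine Finset.sum_congr rfl fun j _ => ?_
        simp only [vecMul, dotProduct, sq, mul_comm (e _)]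
      rw [h2] at h1
      have h3 := frobenius_inv_mul_le hm hA (headDesign k lam X)
      calc _ ≤ 8 * (M / n) ^ 2 * (32 * σ ^ 2 * t * ((3 / 2 * n * k) / m ^ 2)) := by
            refine h1.trans ?_
            gcongr
            refine hN₁.trans ?_
            gcongr
            refine h3.trans ?_
            gcongr
        _ = _ := by field_simp; ring
    have htail : ∑ j, tail k lam j ^ 2 * (v ᵥ* tailDesign k lam X) j ^ 2 ≤
        σ ^ 2 * t * (32 * K * (n / m ^ 2) * tailSqSum k lam) := by
      have h2 : ∑ j, tail k lam j ^ 2 * (v ᵥ* tailDesign k lam X) j ^ 2 =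
          ∑ j, (∑ i, ((gram l (of X))⁻¹ *
            tailDesign k lam X * diagonal (tail k lam)) i j * e i) ^ 2 := by
        have : v ᵥ* tailDesign k lam X = e ᵥ* ((gram l (of X))⁻¹ * tailDesign k lam X) := by
          rw [← vecMul_vecMul, ← mulVec_transpose (gram l (of X))⁻¹, hgsym]
        rw [this]
        refine Finset.sum_congr rfl fun j _ => ?_
        simp only [mul_diagonal, vecMul, dotProduct]
        rw [← mul_pow, Finset.mul_sum]
        congr 1
        exact Finset.sum_congr rfl fun i _ => by ring
      have h3 := frobenius_inv_mul_le hm hAg (tailDesign k lam X * diagonal (tail k lam))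
      rw [← Matrix.mul_assoc] at h3
      have h4 : ∑ i, ∑ j, (tailDesign k lam X * diagonal (tail k lam)) i j ^ 2 ≤
          K * n * tailSqSum k lam := by
        refine le_of_eq_of_le ?_ hF
        refine Finset.sum_congr rfl fun i _ => Finset.sum_congr rfl fun j _ => ?_
        rw [mul_diagonal]; ring
      rw [h2]
      calc _ ≤ 32 * σ ^ 2 * t * ((K * n * tailSqSum k lam) / m ^ 2) := by
            refine hN₂.trans ?_
            gcongr
            refine h3.trans ?_
            gcongr
        _ = _ := by ring
    rw [div_le_iff₀ (by positivity), hvar]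
    linarith

end

end

/-! ### Assembling the exceptional events -/

section

lemma goodEvent_mono {Ω : Type*} {n p : ℕ} {σε : ℝ} {lam : Fin p → ℝ}
    {X : Ω → Fin n → Fin p → ℝ} {ε : Ω → Fin n → ℝ} {t l : ℝ} {θ : Fin p → ℝ} {bB bB' bV bV' : ℝ} (hB : bB ≤ bB')
    (hV : bV ≤ bV') :
    goodEvent σε t lam l X ε θ bB bV ⊆ goodEvent σε t lam l X ε θ bB' bV' :=
  fun _ h => ⟨h.1, h.2.1.trans hB, h.2.2.trans hV⟩

variable {Ω : Type*} [MeasurableSpace Ω] {μ : Measure Ω} [IsProbabilityMeasure μ]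
  {n p : ℕ} {σx σε : ℝ} {lam : Fin p → ℝ} {X : Ω → Fin n → Fin p → ℝ} {ε : Ω → Fin n → ℝ}

/-- The constant in the bound for the bias: `P` bounds the condition number of the tail Gram
matrix, `R` the norm of its weighted version. -/
def biasConst (K P R : ℝ) : ℝ := (1 + 8 * R) * (8 + 16 * K * P ^ 2) + 2 + 4 * R * K

lemma measurable_tailGram (k : ℕ) (l : ℝ) (i i' : Fin n) :
    Measurable fun x : Fin n → Fin p → ℝ => tailGram k lam l x i i' := by
  simp only [tailGram, colGram, tailDesign, Matrix.add_apply, of_apply]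
  fun_prop

lemma measurable_gram (l : ℝ) (i i' : Fin n) :
    Measurable fun x : Fin n → Fin p → ℝ => gram l (of x) i i' := by
  simp only [gram, Matrix.add_apply, Matrix.mul_apply, transpose_apply, of_apply]
  fun_prop

/-- If the spectrum of the tail Gram matrix is controlled outside of `S`, then the bounds for
bias and variance hold outside of `S` and an event of exponentially small probability. -/
lemma measureReal_goodEvent_ge (h : Model μ σx σε lam X ε) {b : ℝ} (hb : 0 < b) (hb1 : b ≤ 1)
    (hiso : IsoDesign μ b fun i j ω => X ω i j / √(lam j)) (hn : 0 < n) (hσ : 0 < σε)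
    (θ : Fin p → ℝ) (k : ℕ) {t l m M G R P : ℝ} (ht : 0 < t) (hm : 0 < m) (hM : M = P * m)
    (hP : 0 < P) (hR0 : 0 ≤ R) (hR : G * n ≤ R * m ^ 2) {S : Set Ω}
    (hS : ∀ ω, ω ∉ S → ∀ v : Fin n → ℝ,
      m * (v ⬝ᵥ v) ≤ l * (v ⬝ᵥ v) +
        ∑ j, tail k lam j * (∑ i, v i * tailDesign k lam (X ω) i j) ^ 2 ∧
      l * (v ⬝ᵥ v) + ∑ j, tail k lam j * (∑ i, v i * tailDesign k lam (X ω) i j) ^ 2 ≤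
        M * (v ⬝ᵥ v) ∧
      ∑ j, tail k lam j ^ 2 * (∑ i, v i * tailDesign k lam (X ω) i j) ^ 2 ≤ G * (v ⬝ᵥ v)) :
    1 - (μ.real S + 5 ^ k * (2 * Real.exp (-(b ^ 2 / 2 ^ 21 * n))) + 2 * Real.exp (-n) +
        4 * Real.exp (-t)) ≤
      μ.real (goodEvent σε t lam l X ε θ
        (biasConst (2 / b) P R * (tailTerm k lam θ + (M / n) ^ 2 * headTerm k lam θ))
        (384 * P ^ 2 * (k / n) + 64 / b * (n / m ^ 2) * tailSqSum k lam)) := by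
  have hlam := h.eig_pos
  have hM0 : 0 < M := hM ▸ mul_pos hP hm
  have hPm : M / m = P := by rw [hM]; field_simp
  have hh := hiso.restrict fun j : Fin p => (j : ℕ) < k
  have ht' := hiso.restrict fun j : Fin p => k ≤ (j : ℕ)
  -- Doubling σε makes the norm bound strict; the noise constant 8/b then equals 32 σε².
  have hε : ∀ i, SqExpLE μ (1 / (2 * σε) ^ 2) fun ω => ε ω i := fun i => by
    have := h.measurable_noise
    refine sqExpLE_of_psi2Norm_lt (by fun_prop) (by positivity)
      (lt_of_le_of_lt (h.noise_subgaussian i) ?_)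
    exact (ENNReal.ofReal_lt_ofReal_iff (by positivity)).2 (by linarith)
  have e8 : 8 / (1 / (2 * σε) ^ 2) = 32 * σε ^ 2 := by field_simp; norm_num
  set S₁ := {ω | ¬ ∀ w, |∑ i, (∑ j, w j * headDesign k lam (X ω) i j) ^ 2 - n * (w ⬝ᵥ w)| ≤
      n / 2 * (w ⬝ᵥ w)} with hS₁
  set S₂ := {ω | ¬ ∑ i, (∑ j, √(tail k lam j) * tail k θ j * tailDesign k lam (X ω) i j) ^ 2 ≤
      2 / b * n * tailTerm k lam θ} with hS₂
  set S₃ := {ω | ¬ ∑ i, ∑ j, tail k lam j ^ 2 * tailDesign k lam (X ω) i j ^ 2 ≤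
      2 / b * n * tailSqSum k lam} with hS₃
  set S₄ := {ω | ¬ ∑ j, (∑ i, ((tailGram k lam l (X ω))⁻¹ * headDesign k lam (X ω)) i j *
      ε ω i) ^ 2 ≤ 32 * σε ^ 2 * t *
        ∑ i, ∑ j, ((tailGram k lam l (X ω))⁻¹ * headDesign k lam (X ω)) i j ^ 2} with hS₄
  set S₅ := {ω | ¬ ∑ j, (∑ i, ((gram l (of (X ω)))⁻¹ *
        tailDesign k lam (X ω) * diagonal (tail k lam)) i j * ε ω i) ^ 2 ≤
      32 * σε ^ 2 * t * ∑ i, ∑ j, ((gram l (of (X ω)))⁻¹ *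
        tailDesign k lam (X ω) * diagonal (tail k lam)) i j ^ 2} with hS₅
  have p₁ : μ.real S₁ ≤ 5 ^ k * (2 * Real.exp (-(b ^ 2 / 2 ^ 21 * n))) := by
    refine (hh.measureReal_empirical_le hb hb1).trans ?_
    gcongr
    · norm_num
    · exact card_head_le p k
  have p₂ : μ.real S₂ ≤ Real.exp (-n) := by
    have := ht'.measureReal_sum_sq_row_le hb fun j => √(tail k lam j) * tail k θ j
    have e : (fun j => √(tail k lam j) * tail k θ j) ⬝ᵥ (fun j => √(tail k lam j) * tail k θ j) =
        tailTerm k lam θ := by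
      rw [tailTerm_eq k hlam]
      refine Finset.sum_congr rfl fun j _ => ?_
      have : √(tail k lam j) ^ 2 = tail k lam j := Real.sq_sqrt (hlam j).le
      calc _ = √(tail k lam j) ^ 2 * tail k θ j ^ 2 := by ring
        _ = _ := by rw [this]
    have e' : 2 * (n : ℝ) / b = 2 / b * n := by ring
    rw [e, e'] at this
    exact this
  have p₃ : μ.real S₃ ≤ Real.exp (-n) := by
    have := ht'.measureReal_frobenius_le hb (w := fun j => tail k lam j ^ 2)
      fun j => sq_nonneg _
    have e' : 2 * (n : ℝ) / b = 2 / b * n := by ring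
    rw [e'] at this
    exact this
  have p₄ : μ.real S₄ ≤ 2 * Real.exp (-t) := by
    have := measureReal_noise_random_le h.measurable_design h.measurable_noise
      h.noise_indep_design h.noise_indep h.noise_centered (by positivity) hε
      (B := fun x => (tailGram k lam l x)⁻¹ * headDesign k lam x) (fun i j => by
        simp only [Matrix.mul_apply]
        refine Finset.measurable_sum _ fun i' _ =>
          (measurable_matrix_inv_apply (measurable_tailGram k l) i i').mul ?_
        simp only [headDesign, of_apply]
        fun_prop) t
    rwa [e8] at this
  have p₅ : μ.real S₅ ≤ 2 * Real.exp (-t) := by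
    have := measureReal_noise_random_le h.measurable_design h.measurable_noise
      h.noise_indep_design h.noise_indep h.noise_centered (by positivity) hε
      (B := fun x => (gram l (of x))⁻¹ * tailDesign k lam x * diagonal (tail k lam))
      (fun i j => by
        simp only [mul_diagonal]
        simp only [Matrix.mul_apply]
        refine (Finset.measurable_sum _ fun i' _ =>
          (measurable_matrix_inv_apply (measurable_gram l) i i').mul ?_).mul_const _
        simp only [tailDesign, of_apply]
        fun_prop) t
    rwa [e8] at this
  set E := goodEvent σε t lam l X ε θ
        (biasConst (2 / b) P R * (tailTerm k lam θ + (M / n) ^ 2 * headTerm k lam θ))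
        (384 * P ^ 2 * (k / n) + 64 / b * (n / m ^ 2) * tailSqSum k lam) with hE
  have hcover : (Set.univ : Set Ω) ⊆ E ∪ (S ∪ S₁ ∪ S₂ ∪ S₃ ∪ S₄ ∪ S₅) := by
    intro ω _
    by_contra hc
    simp only [Set.mem_union, not_or] at hc
    obtain ⟨hcE, ⟨⟨⟨⟨c₀, c₁⟩, c₂⟩, c₃⟩, c₄⟩, c₅⟩ := hc
    simp only [hS₁, hS₂, hS₃, hS₄, hS₅, Set.mem_ofPred_eq, not_not] at c₁ c₂ c₃ c₄ c₅
    have hc₀ := hS ω c₀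
    have := good_of_bounds hn hlam (l := l) (X := X ω) (e := ε ω) (θ := θ) (m := m) (M := M)
      (K := 2 / b) (G := G) (R := R) hm hM0 (by positivity) hR0 hσ ht
      (fun v => by rw [quadForm_tailGram]; exact (hc₀ v).1)
      (fun v => by rw [quadForm_tailGram]; exact (hc₀ v).2.1) c₁ c₂ (fun v => (hc₀ v).2.2) hR
      c₃ c₄ c₅
    rw [hPm] at this
    refine hcE ⟨this.1, this.2.1, this.2.2.trans_eq ?_⟩
    ring
  have hle := measureReal_mono (μ := μ) hcover
  rw [probReal_univ] at hle
  have u₁ := measureReal_union_le (μ := μ) E (S ∪ S₁ ∪ S₂ ∪ S₃ ∪ S₄ ∪ S₅)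
  have u₂ := measureReal_union_le (μ := μ) (S ∪ S₁ ∪ S₂ ∪ S₃ ∪ S₄) S₅
  have u₃ := measureReal_union_le (μ := μ) (S ∪ S₁ ∪ S₂ ∪ S₃) S₄
  have u₄ := measureReal_union_le (μ := μ) (S ∪ S₁ ∪ S₂) S₃
  have u₅ := measureReal_union_le (μ := μ) (S ∪ S₁) S₂
  have u₆ := measureReal_union_le (μ := μ) S S₁
  linarith

/-- The exceptional probabilities are of order `exp (-t / c)`. -/
lemma exceptional_le {b c t : ℝ} {k : ℕ} (hb : 0 < b) (hb1 : b ≤ 1) (hc : 2 ^ 23 / b ^ 2 ≤ c)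
    (hk : (k : ℝ) < n / c) (ht : c < t) (htn : t < n / c) :
    5 ^ k * (2 * Real.exp (-(b ^ 2 / 2 ^ 21 * n))) ≤ 2 * Real.exp (-t / c) ∧
      Real.exp (-n) ≤ Real.exp (-t / c) ∧ Real.exp (-t) ≤ Real.exp (-t / c) := by
  have hb2 : b ^ 2 ≤ 1 := pow_le_one₀ hb.le hb1
  have hc1 : 1 ≤ c := by
    refine le_trans ?_ hc
    rw [le_div_iff₀ (by positivity)]
    norm_num
    linarith
  have hc0 : 0 < c := by linarith
  have ht0 : 0 < t := by linarith
  have htc : t / c ≤ t := div_le_self ht0.le hc1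
  have hnt : c * t < n := by
    rw [lt_div_iff₀ hc0] at htn; linarith
  have hcb : 2 ^ 23 ≤ c * b ^ 2 := by
    rwa [div_le_iff₀ (by positivity)] at hc
  have hck : c * k < n := by
    rw [lt_div_iff₀ hc0] at hk; linarith
  refine ⟨?_, Real.exp_le_exp.2 ?_, Real.exp_le_exp.2 ?_⟩
  · have h5 : (5 : ℝ) ^ k ≤ Real.exp (2 * k) := by
      have := five_pow_mul_exp_le k
      rw [← le_div_iff₀ (Real.exp_pos _), ← Real.exp_sub] at this
      refine this.trans_eq ?_
      congr 1; ring
    -- By the choice of c, both k and t are at most b²n/2²³, a quarter of the available exponent, so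
    -- it pays for 5^k ≤ exp(2k) and for t.
    have e1 : 2 * (k : ℝ) + -(b ^ 2 / 2 ^ 21 * n) ≤ -t / c := by
      have i1 : 2 ^ 23 * (k : ℝ) ≤ n * b ^ 2 := by
        calc 2 ^ 23 * (k : ℝ) ≤ c * b ^ 2 * k := by gcongr
          _ = c * k * b ^ 2 := by ring
          _ ≤ n * b ^ 2 := by gcongr
      have i2 : 2 ^ 23 * t ≤ n * b ^ 2 := by
        calc 2 ^ 23 * t ≤ c * b ^ 2 * t := by gcongr
          _ = c * t * b ^ 2 := by ring
          _ ≤ n * b ^ 2 := by gcongr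
      rw [neg_div]
      norm_num at i1 i2 ⊢
      nlinarith
    calc _ ≤ Real.exp (2 * k) * (2 * Real.exp (-(b ^ 2 / 2 ^ 21 * n))) := by gcongr
      _ = 2 * Real.exp (2 * k + -(b ^ 2 / 2 ^ 21 * n)) := by rw [Real.exp_add]; ring
      _ ≤ _ := by gcongr
  · rw [neg_div]; nlinarith
  · rw [neg_div]; linarith

end

/-! ### The three ridge regimes -/

section

lemma tailSum_pos {p k : ℕ} {lam : Fin p → ℝ} (hlam : ∀ j, 0 < lam j) (hkp : k < p) :
    0 < tailSum k lam :=
  Finset.sum_pos (fun j _ => hlam j) ⟨⟨⟨k, hkp⟩, le_rfl⟩, Finset.mem_univ _⟩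

lemma tailSqSum_nonneg {p : ℕ} (k : ℕ) (lam : Fin p → ℝ) : 0 ≤ tailSqSum k lam :=
  Finset.sum_nonneg fun _ _ => sq_nonneg _

lemma tail_le {p k : ℕ} {lam : Fin p → ℝ} (hlam : Antitone lam) (hkp : k < p)
    (j : {j : Fin p // k ≤ (j : ℕ)}) : tail k lam j ≤ lam ⟨k, hkp⟩ :=
  hlam j.2

lemma tailSqSum_le {p k : ℕ} {lam : Fin p → ℝ} (h0 : ∀ j, 0 < lam j) (hlam : Antitone lam)
    (hkp : k < p) : tailSqSum k lam ≤ lam ⟨k, hkp⟩ * tailSum k lam := by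
  rw [tailSqSum, tailSum, Finset.mul_sum]
  refine Finset.sum_le_sum fun j _ => ?_
  rw [sq]
  exact mul_le_mul_of_nonneg_right (tail_le hlam hkp j) (h0 j).le

lemma sum_tail_sq_mul_le {p k : ℕ} {lam : Fin p → ℝ} (h0 : ∀ j, 0 < lam j) (hlam : Antitone lam)
    (hkp : k < p) (f : {j : Fin p // k ≤ (j : ℕ)} → ℝ) :
    ∑ j, tail k lam j ^ 2 * f j ^ 2 ≤ lam ⟨k, hkp⟩ * ∑ j, tail k lam j * f j ^ 2 := by
  rw [Finset.mul_sum]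
  refine Finset.sum_le_sum fun j _ => ?_
  rw [sq (tail k lam j), mul_assoc]
  exact mul_le_mul_of_nonneg_right (tail_le hlam hkp j) (mul_nonneg (h0 j).le (sq_nonneg _))

lemma headTerm_nonneg {p : ℕ} (k : ℕ) (lam θ : Fin p → ℝ) : 0 ≤ headTerm k lam θ := sq_nonneg _

lemma tailTerm_nonneg {p : ℕ} (k : ℕ) (lam θ : Fin p → ℝ) : 0 ≤ tailTerm k lam θ := sq_nonneg _

lemma biasConst_nonneg {K P R : ℝ} (hK : 0 ≤ K) (hR : 0 ≤ R) : 0 ≤ biasConst K P R := by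
  unfold biasConst; positivity

lemma mul_add_mul_le {T H x y q β C : ℝ} (hT : 0 ≤ T) (hH : 0 ≤ H) (hy : 0 ≤ y) (hq : 1 ≤ q)
    (hβ : 0 ≤ β) (hx : x ≤ q * y) (hC : β * q ≤ C) : β * (T + x * H) ≤ C * (T + y * H) := by
  calc β * (T + x * H) ≤ β * (q * T + q * y * H) := by
        gcongr
        exact le_mul_of_one_le_left hT hq
    _ = β * q * (T + y * H) := by ring
    _ ≤ _ := by gcongr

lemma mul_add_le_mul_add {x y q r C : ℝ} (hx : 0 ≤ x) (hy : 0 ≤ y) (hq : q ≤ C) (hr : r ≤ C) :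
    q * x + r * y ≤ C * (x + y) := by
  rw [mul_add]
  gcongr

lemma iIndepFun_tailDesign {Ω : Type*} [MeasurableSpace Ω] {μ : Measure Ω}
    {n p : ℕ} {lam : Fin p → ℝ} {X : Ω → Fin n → Fin p → ℝ}
    (hcol : ∀ i, iIndepFun (fun j ω => X ω i j) μ)
    (k : ℕ) (i : Fin n) :
    iIndepFun (fun (j : {j : Fin p // k ≤ (j : ℕ)}) ω => X ω i j / √(lam j)) μ :=
  ((hcol i).comp (fun j x => x / √(lam j)) fun j => by fun_prop).precomp
    Subtype.val_injective

variable {Ω : Type*} [MeasurableSpace Ω] {μ : Measure Ω} [IsProbabilityMeasure μ]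
  {n p : ℕ} {σx σε : ℝ} {lam : Fin p → ℝ} {X : Ω → Fin n → Fin p → ℝ} {ε : Ω → Fin n → ℝ}

/-- Explicit regularization of the order of the leading tail eigenvalue. -/
lemma goodEvent_large_ridge (h : Model μ σx σε lam X ε) {b : ℝ} (hb : 0 < b) (hb1 : b ≤ 1)
    (hiso : IsoDesign μ b fun i j ω => X ω i j / √(lam j)) (hn : 0 < n) (hσ : 0 < σε)
    (θ : Fin p → ℝ) {k : ℕ} (hkp : k < p) {a c C t P R : ℝ} (ha : 0 < a)
    (hc : 2 ^ 23 / b ^ 2 ≤ c) (hk : (k : ℝ) < n / c) (hct : c < t) (htn : t < n / c)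
    (hR : R = 768 / b * (a + 1)) (hP : P = 1 + R)
    (hC₁ : biasConst (2 / b) P R * P ^ 2 ≤ C) (hC₂ : 384 * P ^ 2 ≤ C) (hC₃ : 64 / b ≤ C)
    (hsum : tailSum k lam ≤ a * (n * lam ⟨k, hkp⟩)) :
    1 - 26 * Real.exp (-t / c) ≤
      μ.real (goodEvent σε t lam (n * lam ⟨k, hkp⟩) X ε θ
        (C * (tailTerm k lam θ + lam ⟨k, hkp⟩ ^ 2 * headTerm k lam θ))
        (C * (k / n + tailSqSum k lam / (n * lam ⟨k, hkp⟩ ^ 2)))) := by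
  have hlam := h.eig_pos
  have hn' : (0 : ℝ) < n := Nat.cast_pos.2 hn
  have hc0 : 0 < c := lt_of_lt_of_le (by positivity) hc
  have ht' := hiso.restrict fun j : Fin p => k ≤ (j : ℕ)
  set L := lam ⟨k, hkp⟩ with hL
  have hL0 : 0 < L := hlam _
  have hR0 : 0 < R := by rw [hR]; positivity
  have hP1 : 1 ≤ P := by linarith
  have hbad := ht'.measureReal_colGram_le hb (w := tail k lam) (L := L) (fun j => (hlam j).le)
    (tail_le h.eig_antitone hkp) hL0
  have hB : 768 / b * (tailSum k lam + n * L) ≤ R * (n * L) := by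
    rw [hR, mul_assoc]
    gcongr
    linarith
  -- The ridge itself is the lower spectral bound, so the random part is only estimated from above.
  have key := measureReal_goodEvent_ge h hb hb1 hiso hn hσ θ k (t := t) (l := n * L)
    (m := n * L) (M := P * (n * L)) (G := L * (R * (n * L))) (R := R) (P := P) (hc0.trans hct)
    (by positivity) rfl (by linarith) hR0.le (le_of_eq (by ring))
    (S := {ω | ¬ ∀ v : Fin n → ℝ, ∑ j, tail k lam j *
      (∑ i, v i * tailDesign k lam (X ω) i j) ^ 2 ≤
      768 / b * (tailSum k lam + n * L) * (v ⬝ᵥ v)}) (by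
      intro ω hω v
      simp only [Set.mem_ofPred_eq, not_not] at hω
      have h1 := (hω v).trans (mul_le_mul_of_nonneg_right hB (dotProduct_self_nonneg' v))
      have h0 : 0 ≤ ∑ j, tail k lam j * (∑ i, v i * tailDesign k lam (X ω) i j) ^ 2 :=
        Finset.sum_nonneg fun j _ => mul_nonneg (hlam j).le (sq_nonneg _)
      refine ⟨by linarith, by rw [hP]; linarith, ?_⟩
      refine (sum_tail_sq_mul_le hlam h.eig_antitone hkp _).trans ?_
      rw [mul_assoc L]
      exact mul_le_mul_of_nonneg_left h1 hL0.le)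
  obtain ⟨e1, e2, e3⟩ := exceptional_le hb hb1 hc hk hct htn
  have hbad' : μ.real {ω | ¬ ∀ v : Fin n → ℝ, ∑ j, tail k lam j *
      (∑ i, v i * tailDesign k lam (X ω) i j) ^ 2 ≤
      768 / b * (tailSum k lam + n * L) * (v ⬝ᵥ v)} ≤ Real.exp (-n) := hbad
  have hexp := Real.exp_pos (-t / c)
  refine le_trans ?_ (key.trans (measureReal_mono (goodEvent_mono ?_ ?_)))
  · linarith
  · refine mul_add_mul_le (tailTerm_nonneg _ _ _) (headTerm_nonneg _ _ _) (sq_nonneg _)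
      (one_le_pow₀ hP1) (biasConst_nonneg (by positivity) hR0.le) (le_of_eq ?_) hC₁
    field_simp
  · have e : 64 / b * (n / (n * L) ^ 2) * tailSqSum k lam =
        64 / b * (tailSqSum k lam / (n * L ^ 2)) := by field_simp
    rw [e]
    exact mul_add_le_mul_add (by positivity)
      (div_nonneg (tailSqSum_nonneg k lam) (by positivity)) hC₂ hC₃

/-- Tail of large effective rank: nonnegative regularization. -/
lemma goodEvent_nonneg_ridge (h : Model μ σx σε lam X ε) {b : ℝ} (hb : 0 < b) (hb1 : b ≤ 1)
    (hiso : IsoDesign μ b fun i j ω => X ω i j / √(lam j)) (hn : 0 < n) (hσ : 0 < σε)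
    (θ : Fin p → ℝ) {k : ℕ} (hkp : k < p) {c C t : ℝ}
    (hc : 2 ^ 23 / b ^ 2 ≤ c) (hc' : (4 * (11264 / b)) ^ 2 ≤ c)
    (hk : (k : ℝ) < n / c) (hct : c < t) (htn : t < n / c)
    (hC₁ : biasConst (2 / b) 6 6 * 9 ≤ C) (hC₂ : 384 * 6 ^ 2 ≤ C) (hC₃ : 256 / b ≤ C)
    (hcol : ∀ i, iIndepFun (fun j ω => X ω i j) μ)
    (hsum : c * n * lam ⟨k, hkp⟩ ≤ tailSum k lam) {l : ℝ} (hl0 : 0 ≤ l) (hl : l < tailSum k lam) :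
    1 - 22 * Real.exp (-t / c) ≤
      μ.real (goodEvent σε t lam l X ε θ
        (C * (tailTerm k lam θ + headTerm k lam θ * (tailSum k lam / n) ^ 2))
        (C * (k / n + n * tailSqSum k lam / tailSum k lam ^ 2))) := by
  have hlam := h.eig_pos
  have hn' : (0 : ℝ) < n := Nat.cast_pos.2 hn
  have hc0 : 0 < c := lt_of_lt_of_le (by positivity) hc
  have ht' := hiso.restrict fun j : Fin p => k ≤ (j : ℕ)
  set L := lam ⟨k, hkp⟩ with hL
  have hL0 : 0 < L := hlam _
  set s := tailSum k lam with hs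
  have hs0 : 0 < s := tailSum_pos hlam hkp
  set g := 11264 / b with hg
  have hg1 : 1 ≤ g := by
    rw [hg, le_div_iff₀ hb]; linarith
  have hbad := ht'.measureReal_colGram_sub_le hb
    (iIndepFun_tailDesign hcol k) hn (w := tail k lam) (L := L)
    (fun j => (hlam j).le) (tail_le h.eig_antitone hkp) hL0
  have hc1 : 1 ≤ c := by nlinarith
  -- Since ∑_{i>k} λ_i² ≤ Ls and nL ≤ s/c, the square root is at most s/√c; this is why c must
  -- exceed (4g)².
  have hdev : g * (n * L + √(n * tailSqSum k lam)) ≤ s / 2 := by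
    have h1 : n * L ≤ s / (4 * g) := by
      rw [le_div_iff₀ (by positivity)]
      have : 4 * g ≤ c := by nlinarith
      calc n * L * (4 * g) ≤ n * L * c := by gcongr
        _ = c * n * L := by ring
        _ ≤ s := hsum
    have h2 : √(n * tailSqSum k lam) ≤ s / (4 * g) := by
      refine Real.sqrt_le_iff.2 ⟨by positivity, ?_⟩
      rw [div_pow, le_div_iff₀ (by positivity)]
      calc n * tailSqSum k lam * (4 * g) ^ 2 ≤ n * (L * s) * c := by
            gcongr
            exact tailSqSum_le hlam h.eig_antitone hkp
        _ = c * n * L * s := by ring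
        _ ≤ s * s := by gcongr
        _ = s ^ 2 := by ring
    calc g * (n * L + √(n * tailSqSum k lam)) ≤ g * (s / (4 * g) + s / (4 * g)) := by gcongr
      _ = s / 2 := by field_simp; ring
  have hnL : n * L ≤ s := by
    calc n * L = 1 * n * L := by ring
      _ ≤ c * n * L := by gcongr
      _ ≤ s := hsum
  -- The tail Gram matrix lies between s/2 and 3s/2, and a ridge in [0, s) raises the upper bound to
  -- 5s/2 at most, within 6(s/2). R = 6 comes from nL · 3s/2 ≤ 6(s/2)².
  have key := measureReal_goodEvent_ge h hb hb1 hiso hn hσ θ k (t := t) (l := l)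
    (m := s / 2) (M := 6 * (s / 2)) (G := L * (3 / 2 * s)) (R := 6) (P := 6) (hc0.trans hct)
    (by positivity) rfl (by norm_num) (by norm_num) (by nlinarith)
    (S := {ω | ¬ ∀ v : Fin n → ℝ, |∑ j, tail k lam j *
      (∑ i, v i * tailDesign k lam (X ω) i j) ^ 2 - s * (v ⬝ᵥ v)| ≤
      g * (n * L + √(n * tailSqSum k lam)) * (v ⬝ᵥ v)}) (by
      intro ω hω v
      simp only [Set.mem_ofPred_eq, not_not] at hω
      have hv := dotProduct_self_nonneg' v
      have h1 := abs_le.1 ((hω v).trans (mul_le_mul_of_nonneg_right hdev hv))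
      have h2 := mul_nonneg hl0 hv
      have h3 := mul_le_mul_of_nonneg_right hl.le hv
      have h4 := mul_nonneg hs0.le hv
      refine ⟨by linarith, by linarith, ?_⟩
      refine (sum_tail_sq_mul_le hlam h.eig_antitone hkp _).trans ?_
      rw [mul_assoc L]
      exact mul_le_mul_of_nonneg_left (by linarith) hL0.le)
  obtain ⟨e1, e2, e3⟩ := exceptional_le hb hb1 hc hk hct htn
  have hbad' : μ.real {ω | ¬ ∀ v : Fin n → ℝ, |∑ j, tail k lam j *
      (∑ i, v i * tailDesign k lam (X ω) i j) ^ 2 - s * (v ⬝ᵥ v)| ≤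
      g * (n * L + √(n * tailSqSum k lam)) * (v ⬝ᵥ v)} ≤ 2 * Real.exp (-n) := hbad
  have hexp := Real.exp_pos (-t / c)
  refine le_trans ?_ (key.trans (measureReal_mono (goodEvent_mono ?_ ?_)))
  · linarith
  · rw [mul_comm (headTerm k lam θ)]
    refine mul_add_mul_le (tailTerm_nonneg _ _ _) (headTerm_nonneg _ _ _) (sq_nonneg _)
      (by norm_num) (biasConst_nonneg (by positivity) (by norm_num)) (le_of_eq ?_) hC₁
    ring
  · have e : 64 / b * (n / (s / 2) ^ 2) * tailSqSum k lam =
        256 / b * (n * tailSqSum k lam / s ^ 2) := by field_simp; ring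
    rw [e]
    exact mul_add_le_mul_add (by positivity)
      (div_nonneg (mul_nonneg hn'.le (tailSqSum_nonneg k lam)) (by positivity)) hC₂ hC₃

/-- Tail of large effective rank: regularization that may be negative. -/
lemma goodEvent_negative_ridge (h : Model μ σx σε lam X ε) {b : ℝ} (hb : 0 < b) (hb1 : b ≤ 1)
    (hiso : IsoDesign μ b fun i j ω => X ω i j / √(lam j)) (hn : 0 < n) (hσ : 0 < σε)
    (θ : Fin p → ℝ) {k : ℕ} (hkp : k < p) {c C t : ℝ}
    (hc : 2 ^ 23 / b ^ 2 ≤ c) (hc' : 2 * (11264 / b) ≤ c)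
    (hk : (k : ℝ) < n / c) (hct : c < t) (htn : t < n / c)
    (hC₁ : biasConst (2 / b) 4 (3072 / b) * 8 ≤ C) (hC₂ : 384 * 4 ^ 2 ≤ C) (hC₃ : 256 / b ≤ C)
    (hcol : ∀ i, iIndepFun (fun j ω => X ω i j) μ) {ξ : ℝ} (hξ : c < ξ) :
    1 - 20 * Real.exp (-t / c) ≤
      μ.real (goodEvent σε t lam
        (-tailSum k lam + ξ * (n * lam ⟨k, hkp⟩ + √(n * tailSqSum k lam))) X ε θ
        (C * (tailTerm k lam θ + headTerm k lam θ *
          (ξ ^ 2 / n * (n * lam ⟨k, hkp⟩ ^ 2 + tailSqSum k lam))))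
        (C * (k / n + tailSqSum k lam /
          (ξ ^ 2 * (n * lam ⟨k, hkp⟩ ^ 2 + tailSqSum k lam))))) := by
  have hlam := h.eig_pos
  have hn' : (0 : ℝ) < n := Nat.cast_pos.2 hn
  have hc0 : 0 < c := lt_of_lt_of_le (by positivity) hc
  have ht' := hiso.restrict fun j : Fin p => k ≤ (j : ℕ)
  set L := lam ⟨k, hkp⟩ with hL
  have hL0 : 0 < L := hlam _
  set s := tailSum k lam with hs
  set q := tailSqSum k lam with hq
  have hq0 : 0 ≤ q := tailSqSum_nonneg k lam
  set g := 11264 / b with hg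
  have hg1 : 1 ≤ g := by
    rw [hg, le_div_iff₀ hb]; linarith
  set D := n * L + √(n * q) with hD
  have hD0 : 0 < D := by positivity
  have hsq : √(n * q) ^ 2 = n * q := Real.sq_sqrt (by positivity)
  have hDlow : n * (n * L ^ 2 + q) ≤ D ^ 2 := by
    have : 0 ≤ n * L * √(n * q) := by positivity
    rw [hD]; nlinarith
  have hDup : D ^ 2 ≤ 2 * (n * (n * L ^ 2 + q)) := by
    rw [hD]; nlinarith [sq_nonneg (n * L - √(n * q))]
  have hξ1 : 1 ≤ ξ := by linarith
  have hgξ : 2 * g ≤ ξ := hc'.trans hξ.le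
  have hbad₁ := ht'.measureReal_colGram_sub_le hb
    (iIndepFun_tailDesign hcol k) hn (w := tail k lam) (L := L)
    (fun j => (hlam j).le) (tail_le h.eig_antitone hkp) hL0
  -- The Gram matrix with squared weights is bounded directly: L times the ordinary Gram matrix
  -- would involve s, which ξD need not dominate.
  have hbad₂ := ht'.measureReal_colGram_le hb (w := fun j => tail k lam j ^ 2) (L := L ^ 2)
    (fun j => sq_nonneg _)
    (fun j => pow_le_pow_left₀ (hlam j).le (tail_le h.eig_antitone hkp j) 2) (by positivity)
  set S₁ := {ω | ¬ ∀ v : Fin n → ℝ, |∑ j, tail k lam j *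
      (∑ i, v i * tailDesign k lam (X ω) i j) ^ 2 - s * (v ⬝ᵥ v)| ≤ g * D * (v ⬝ᵥ v)} with hS₁
  set S₂ := {ω | ¬ ∀ v : Fin n → ℝ, ∑ j, tail k lam j ^ 2 *
      (∑ i, v i * tailDesign k lam (X ω) i j) ^ 2 ≤
      768 / b * (q + n * L ^ 2) * (v ⬝ᵥ v)} with hS₂
  have hp₁ : μ.real S₁ ≤ 2 * Real.exp (-n) := hbad₁
  have hp₂ : μ.real S₂ ≤ Real.exp (-n) := hbad₂
  -- The ridge cancels the mean s and leaves ξD with error gD ≤ ξD/2, hence a spectrum between ξD/2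
  -- and 3ξD/2.
  have key := measureReal_goodEvent_ge h hb hb1 hiso hn hσ θ k (t := t) (l := -s + ξ * D)
    (m := ξ * D / 2) (M := 4 * (ξ * D / 2)) (G := 768 / b * (q + n * L ^ 2)) (R := 3072 / b)
    (P := 4) (hc0.trans hct) (by positivity) rfl (by norm_num) (by positivity) (by
      calc 768 / b * (q + n * L ^ 2) * n = 768 / b * (n * (n * L ^ 2 + q)) := by ring
        _ ≤ 768 / b * (ξ ^ 2 * D ^ 2) := by
            refine mul_le_mul_of_nonneg_left ?_ (by positivity)
            exact hDlow.trans (le_mul_of_one_le_left (by positivity) (one_le_pow₀ hξ1))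
        _ = _ := by ring)
    (S := S₁ ∪ S₂) (by
      intro ω hω v
      simp only [hS₁, hS₂, Set.mem_union, not_or, Set.mem_ofPred_eq, not_not] at hω
      have hv := dotProduct_self_nonneg' v
      have h1 := abs_le.1 (hω.1 v)
      have h2 : 2 * (g * D * (v ⬝ᵥ v)) ≤ ξ * D * (v ⬝ᵥ v) := by
        calc 2 * (g * D * (v ⬝ᵥ v)) = 2 * g * D * (v ⬝ᵥ v) := by ring
          _ ≤ _ := by gcongr
      have h3 : 0 ≤ ξ * D * (v ⬝ᵥ v) := by positivity
      exact ⟨by linarith, by linarith, hω.2 v⟩)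
  obtain ⟨e1, e2, e3⟩ := exceptional_le hb hb1 hc hk hct htn
  have hu := measureReal_union_le (μ := μ) S₁ S₂
  have hexp := Real.exp_pos (-t / c)
  refine le_trans ?_ (key.trans (measureReal_mono (goodEvent_mono ?_ ?_)))
  · linarith
  · rw [mul_comm (headTerm k lam θ)]
    refine mul_add_mul_le (tailTerm_nonneg _ _ _) (headTerm_nonneg _ _ _) (by positivity)
      (by norm_num) (biasConst_nonneg (by positivity) (by positivity)) ?_ hC₁
    calc (4 * (ξ * D / 2) / n) ^ 2 = 4 * ξ ^ 2 / n ^ 2 * D ^ 2 := by ring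
      _ ≤ 4 * ξ ^ 2 / n ^ 2 * (2 * (n * (n * L ^ 2 + q))) := by gcongr
      _ = _ := by field_simp; ring
  · have e : 64 / b * (n / (ξ * D / 2) ^ 2) * q ≤
        256 / b * (q / (ξ ^ 2 * (n * L ^ 2 + q))) := by
      calc 64 / b * (n / (ξ * D / 2) ^ 2) * q = 256 / b * (n * q / (ξ ^ 2 * D ^ 2)) := by
            field_simp; ring
        _ ≤ 256 / b * (n * q / (ξ ^ 2 * (n * (n * L ^ 2 + q)))) := by gcongr
        _ = _ := by field_simp
    exact (add_le_add_right e _).trans (mul_add_le_mul_add (by positivity)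
      (by positivity) hC₂ hC₃)

end

end RidgeRegression

end

/-! ### Choice of the constants -/

open RidgeRegression
theorem mainTheorem3 (σx a : ℝ) (ha : 0 < a) :
    ∃ c C : ℝ, 0 < c ∧ 0 < C ∧
      ∀ {Ω : Type*} [MeasurableSpace Ω] (μ : Measure Ω) [IsProbabilityMeasure μ]
        (n p : ℕ) (σε : ℝ) (_ : 0 < σε) (lam : Fin p → ℝ)
        (X : Ω → Fin n → Fin p → ℝ) (ε : Ω → Fin n → ℝ) (_ : Model μ σx σε lam X ε)
        (θ : Fin p → ℝ) (k : ℕ) (hkp : k < p) (_ : (k : ℝ) < n / c)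
        (t : ℝ) (_ : c < t) (_ : t < n / c),
        -- `lam ⟨k, hkp⟩` is the `(k+1)`-st eigenvalue, as `Fin p` starts at `0`
        (tailSum k lam ≤ a * (n * lam ⟨k, hkp⟩) →
          1 - 26 * Real.exp (-t / c) ≤
            μ.real (goodEvent σε t lam (n * lam ⟨k, hkp⟩) X ε θ
              (C * (tailTerm k lam θ + lam ⟨k, hkp⟩ ^ 2 * headTerm k lam θ))
              (C * (k / n + tailSqSum k lam / (n * lam ⟨k, hkp⟩ ^ 2))))) ∧
        ((∀ i, iIndepFun (fun j ω => X ω i j) μ) → c * n * lam ⟨k, hkp⟩ ≤ tailSum k lam →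
          (∀ l : ℝ, 0 ≤ l → l < tailSum k lam →
            1 - 22 * Real.exp (-t / c) ≤
              μ.real (goodEvent σε t lam l X ε θ
                (C * (tailTerm k lam θ + headTerm k lam θ * (tailSum k lam / n) ^ 2))
                (C * (k / n + n * tailSqSum k lam / tailSum k lam ^ 2)))) ∧
          (∀ ξ : ℝ, c < ξ →
            1 - 20 * Real.exp (-t / c) ≤
              μ.real (goodEvent σε t lam
                (-tailSum k lam + ξ * (n * lam ⟨k, hkp⟩ + √(n * tailSqSum k lam))) X ε θ
                (C * (tailTerm k lam θ + headTerm k lam θ *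
                  (ξ ^ 2 / n * (n * lam ⟨k, hkp⟩ ^ 2 + tailSqSum k lam))))
                (C * (k / n + tailSqSum k lam /
                  (ξ ^ 2 * (n * lam ⟨k, hkp⟩ ^ 2 + tailSqSum k lam))))))) := by
  -- K exceeds σx strictly and is at least 1, so b ≤ 1, also when σx is negative.
  set K : ℝ := max σx 0 + 1 with hKdef
  have hK1 : 1 ≤ K := by linarith [le_max_right σx 0]
  have hK0 : 0 < K := by linarith
  have hσK : σx < K := by linarith [le_max_left σx 0]
  set b : ℝ := 1 / K ^ 2 with hbdef
  have hb : 0 < b := by positivity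
  have hb1 : b ≤ 1 := by
    rw [hbdef, div_le_one (by positivity)]
    exact one_le_pow₀ hK1
  set R : ℝ := 768 / b * (a + 1) with hR
  have hR0 : 0 ≤ R := by positivity
  set P : ℝ := 1 + R with hP
  have hb2 : (0 : ℝ) ≤ 2 / b := by positivity
  have n1 : 0 ≤ biasConst (2 / b) P R * P ^ 2 :=
    mul_nonneg (biasConst_nonneg hb2 hR0) (sq_nonneg _)
  have n2 : 0 ≤ biasConst (2 / b) 6 6 * 9 :=
    mul_nonneg (biasConst_nonneg hb2 (by norm_num)) (by norm_num)
  have n3 : 0 ≤ biasConst (2 / b) 4 (3072 / b) * 8 :=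
    mul_nonneg (biasConst_nonneg hb2 (by positivity)) (by norm_num)
  have n4 : 0 ≤ 384 * P ^ 2 := by positivity
  have n5 : 0 ≤ 64 / b := by positivity
  have n6 : 0 ≤ 2 ^ 23 / b ^ 2 := by positivity
  have n7 : 0 ≤ (4 * (11264 / b)) ^ 2 := by positivity
  have n8 : 0 < 11264 / b := by positivity
  have e256 : 256 / b = 4 * (64 / b) := by ring
  -- Sums of nonnegative terms dominate every requirement at once. The parameter a enters only C,
  -- through P and R.
  refine ⟨2 ^ 23 / b ^ 2 + (4 * (11264 / b)) ^ 2 + 2 * (11264 / b),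
    biasConst (2 / b) P R * P ^ 2 + biasConst (2 / b) 6 6 * 9 +
      biasConst (2 / b) 4 (3072 / b) * 8 + 384 * P ^ 2 + 384 * 6 ^ 2 + 256 / b,
    by linarith, by rw [e256]; linarith, ?_⟩
  intro Ω _ μ _ n p σε hσ lam X ε h θ k hkp hk t hct htn
  -- For n = 0 the interval (c, n/c) is empty, because n/c = 0 < c.
  have hn : 0 < n := by
    rcases Nat.eq_zero_or_pos n with rfl | hn
    · simp only [Nat.cast_zero, zero_div] at htn
      linarith
    · exact hn
  have hiso := isoDesign_of_model h hK0 hσK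
  refine ⟨fun hsum => ?_, fun hcol hsum => ⟨fun l hl0 hl => ?_, fun ξ hξ => ?_⟩⟩
  · exact goodEvent_large_ridge h hb hb1 hiso hn hσ θ hkp ha (by linarith) hk hct htn hR hP
      (by rw [e256]; linarith) (by rw [e256]; linarith) (by rw [e256]; linarith) hsum
  · exact goodEvent_nonneg_ridge h hb hb1 hiso hn hσ θ hkp (by linarith) (by linarith) hk hct htn
      (by rw [e256]; linarith) (by rw [e256]; linarith) (by linarith) hcol hsum hl0 hl
  · exact goodEvent_negative_ridge h hb hb1 hiso hn hσ θ hkp (by linarith) (by linarith) hk hct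
      htn (by rw [e256]; linarith) (by rw [e256]; linarith) (by linarith) hcol hξ
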